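/- Let $n\ge 3$, let $\sigma_1,\sigma_2\in\mathbb C^2$ be fixed spinors with $(12)\neq0$, where $(ij)=\sigma_i^0\sigma_j^1-\sigma_i^1\sigma_j^0$, and let $\xi\in\mathbb C^2\setminus\{0\}$ be a reference spinor. Let $\sigma_3,\dots,\sigma_n$ be variable spinors, $X^I_A$ ($A=0,1$; $I$ running over $4$ even and $4$ odd directions) coordinates on $\mathbb C^{8|8}$, $Z(\sigma)=X_A\sigma^A$, and $W_1,\dots,W_n$ dual twistors with $4$ even and $4$ odd components, regarded as formal variables. For $\Lambda=s^2$ let $\langle C,D\rangle=I_{IJ}C^ID^J$ with $I_{IJ}=\mathrm{diag}(\epsilon,\Lambda\epsilon,s\,\mathbb 1_4)$, let $[\cdot,\cdot]$ be the contraction with $I^{IJ}$, which is $\Lambda$ times the (graded) inverse of $I_{IJ}$, and define $X^2$ by $\langle Z(\sigma),Z(\sigma')\rangle=X^2(\sigma\sigma')$. For a spinor $\zeta$ let $\mathbb H$ be the $n\times n$ Hodges matrix $$\mathbb H_{ij}=-\frac{[W_i,W_j]}{(ij)}\ (i\ne j),\qquad \mathbb H_{ii}=-\sum_{j\neq i}\mathbb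 H_{ij}\frac{(\zeta j)^2}{(\zeta i)^2},$$ with $\zeta=\xi$ unless stated otherwise; let $|\mathbb H^{R}_{C}|$ be its determinant with the rows $R$ and columns $C$ removed (taken with its sign as a cofactor if $R\ne C$), and for $p=1,2$ let $$\omega^p_{ij}=\Lambda\frac{[W_i,W_j](p\xi)^4(ij)}{(pi)^2(pj)^2(\xi i)^2(\xi j)^2}.$$ Write $\int F$ for $\int \frac{d^{8|8}X\,d^{2n}\sigma}{\mathrm{vol}\,GL(2)}\,F\,e^{i\mathcal P\cdot X}$, $\mathcal P\cdot X=\sum_i W_i\cdot Z(\sigma_i)$, where $GL(2)$ is fixed by fixing $\sigma_1,\sigma_2$ (Faddeev–Popov factor $(12)^2$) and where the integral is understood as the class of the integrand modulo total derivatives in $X$ and $\sigma_3,\dots,\sigma_n$; integrands are polynomial in $X$, $W$ and rational in the $\sigma_i$ with poles only at $(ij)=0$ and $(\xi i)=0$. For $\Lambda\neq0$ the MHV amplitude with cosmological constant $\Lambda$ is $$\mathcal M_{n,0}(\Lambda)=\frac1\Lambda\int\Big[(X^2)^2\,|\mathbb H^{12}_{12}|+\sum_{i,j,k,l}\omega^1_{ij}\,\omega^2_{kl}\,|\mathbb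 H^{12ijkl}_{12ijkl}|\Big],$$ the sum being over pairwise distinct $i,j,k,l\in\{3,\dots,n\}$. Then: 1. (Thrice-reduced form.) For every $s\ne0$ and every $i\in\{3,\dots,n\}$, $$\mathcal M_{n,0}(\Lambda)=\int\Big[-2\,X^2\,\frac{(12)^2}{(1i)^2(2i)^2}\,|\mathbb H^{12i}_{12i}|+\frac1\Lambda\sum_{i',j,k,l}\omega^1_{i'j}\,\omega^2_{kl}\,|\mathbb H^{12i'jkl}_{12i'jkl}|\Big],$$ where $\omega^1\omega^2/\Lambda=O(\Lambda)$, so that no negative power of $\Lambda$ remains. 2. (No singularity at $\Lambda=0$.) $\mathcal M_{n,0}(\Lambda)$ is a polynomial in $s=\sqrt\Lambda$ whose coefficients are independent of $s$. 3. (Flat-space limit.) Its value at $\Lambda=0$ is, up to the numerical factor $-2$, Hodges' formula: for every $i\in\{3,\dots,n\}$, with $X^2$, $\mathbb H$ taken at $\Lambda=0$ and with any reference spinor $\zeta$ for which the $(\zeta j)$, $3\le j\le n$, are invertible functions (for example $\zeta=\xi$ or $\zeta=\sigma_1$), $$\lim_{\Lambda\to0}\mathcal M_{n,0}(\Lambda)=-2\int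 X^2\,\frac{(12)^2}{(1i)^2(2i)^2}\,|\mathbb H^{12i}_{12i}| =\frac{-2}{(n-1)(n-2)}\int X^2\Big[\sum_{i,j=3}^n\frac{(12)^2}{(1i)(1j)(2i)(2j)}\,|\mathbb H^{12i}_{12j}|+\sum_{i=3}^n\frac{(12)^2}{(1i)^2(2i)^2}\,|\mathbb H^{12i}_{12i}|\Big].$$ (At $\Lambda=0$, $X^2$ is the determinant of the part of $X$ that can be normalized to the identity by $GL(2)$ instead of fixing $\sigma_1,\sigma_2$; in that normalization $X^2=1$.) -/

import Mathlib

/-!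
Conventions.  There are `n = m + 2` particles: `Sum.inl 0`, `Sum.inl 1` are the two particles
`1, 2` of negative helicity, and `Sum.inr i`, `i : Fin m`, are the remaining `n - 2` particles.
`Λ = s ^ 2`, so that `s` is the square root of the cosmological constant that occurs in the
fermionic part of the infinity twistor.

The group `GL(2)` is fixed by fixing the spinors `σ₁, σ₂` (the parameter `τ`), with
Faddeev-Popov factor `(12) ^ 2`; the remaining integration variables are `X` (8 even and 8 odd
coordinates) and `σᵢ` for the other particles.  An integral is the class of its integrand
`F * exp (i P · X)` modulo total derivatives in the integration variables.
The dual twistors `Wᵢ` are not integrated; they are formal variables (acting as `-i ∂/∂Zᵢ` on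
arbitrary twistor wave functions).
-/

open scoped TensorProduct

noncomputable section

namespace MHV

/-- The particles: two of negative helicity, `m` of positive helicity. -/
abbrev Particle (m : ℕ) : Type := Fin 2 ⊕ Fin m

/-- The even variables: bosonic parts of the `Wᵢ` and of `X`, and the spinors `σᵢ`. -/
inductive EvenVar (m : ℕ) : Type
  | W (i : Particle m) (α : Fin 4)
  | X (α : Fin 4) (A : Fin 2)
  | sig (i : Fin m) (A : Fin 2)

/-- The odd variables: fermionic parts of the `Wᵢ` and of `X`. -/
inductive OddVar (m : ℕ) : Type
  | W (i : Particle m) (a : Fin 4)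
  | X (a : Fin 4) (A : Fin 2)

/-- The `SL(2)`-invariant product `(u v)` of two spinors. -/
def br {R : Type*} [CommRing R] (u v : Fin 2 → R) : R := u 0 * v 1 - u 1 * v 0

/-! ### Extending a derivation to a localization -/

section Localization

variable {A : Type} [CommRing A] [Algebra ℂ A]

/-- `a ↦ a + ε D a`, as a map to the dual numbers over the localization. -/
def dualHom (M : Submonoid A) (D : Derivation ℂ A A) :
    A →+* TrivSqZeroExt (Localization M) (Localization M) where
  toFun a := TrivSqZeroExt.inl (algebraMap A (Localization M) a) +
    TrivSqZeroExt.inr (algebraMap A (Localization M) (D a))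
  map_one' := by ext <;> simp
  map_zero' := by ext <;> simp
  map_add' a b := by ext <;> simp [add_smul]
  map_mul' a b := by
    ext
    · simp
    · simp only [TrivSqZeroExt.snd_add, TrivSqZeroExt.snd_inl, TrivSqZeroExt.snd_inr,
        TrivSqZeroExt.snd_mul, TrivSqZeroExt.fst_add, TrivSqZeroExt.fst_inl,
        TrivSqZeroExt.fst_inr, zero_add, add_zero, Derivation.leibniz, map_add, map_mul,
        smul_eq_mul, op_smul_eq_smul]

theorem dualHom_isUnit (M : Submonoid A) (D : Derivation ℂ A A) (y : M) :
    IsUnit (dualHom M D y) := by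
  rw [TrivSqZeroExt.isUnit_iff_isUnit_fst]
  simpa [dualHom] using IsLocalization.map_units (Localization M) y

/-- The extension of `dualHom` to the localization. -/
def dualLift (M : Submonoid A) (D : Derivation ℂ A A) :
    Localization M →+* TrivSqZeroExt (Localization M) (Localization M) :=
  IsLocalization.lift (M := M) (dualHom_isUnit M D)

theorem dualLift_algebraMap (M : Submonoid A) (D : Derivation ℂ A A) (a : A) :
    dualLift M D (algebraMap A (Localization M) a) = dualHom M D a :=
  IsLocalization.lift_eq _ a

theorem fst_dualLift (M : Submonoid A) (D : Derivation ℂ A A) (x : Localization M) :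
    (dualLift M D x).fst = x := by
  have h : ((TrivSqZeroExt.fstHom (Localization M) (Localization M)
      (Localization M)).toRingHom.comp (dualLift M D)) = RingHom.id _ := by
    apply IsLocalization.ringHom_ext M
    ext a
    simp [dualLift_algebraMap, dualHom]
  exact congrArg (fun f : Localization M →+* Localization M => f x) h

/-- The unique extension of the derivation `D` of `A` to a localization of `A`. -/
def locDer (M : Submonoid A) (D : Derivation ℂ A A) :
    Derivation ℂ (Localization M) (Localization M) :=
  Derivation.mk'
    { toFun := fun x => (dualLift M D x).snd
      map_add' := fun x y => by simp
      map_smul' := fun c x => by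
        have hc : dualLift M D (algebraMap ℂ (Localization M) c) =
            TrivSqZeroExt.inl (algebraMap ℂ (Localization M) c) := by
          rw [IsScalarTower.algebraMap_apply ℂ A (Localization M), dualLift_algebraMap]
          ext <;> simp [dualHom]
        rw [Algebra.smul_def, map_mul, hc]
        simp [Algebra.smul_def] }
    (fun x y => by simp [fst_dualLift, mul_comm])

theorem locDer_algebraMap (M : Submonoid A) (D : Derivation ℂ A A) (a : A) :
    locDer M D (algebraMap A (Localization M) a) = algebraMap A (Localization M) (D a) := by
  change (dualLift M D (algebraMap A (Localization M) a)).snd = _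
  rw [dualLift_algebraMap]
  change (TrivSqZeroExt.inl (algebraMap A (Localization M) a) +
    TrivSqZeroExt.inr (algebraMap A (Localization M) (D a)) :
      TrivSqZeroExt (Localization M) (Localization M)).snd = _
  rw [TrivSqZeroExt.snd_add, TrivSqZeroExt.snd_inl, TrivSqZeroExt.snd_inr, zero_add]

end Localization

/-! ### The algebra of integrands -/

section Integrands

variable (m : ℕ) (τ : Fin 2 → Fin 2 → ℂ) (ξ : Fin 2 → ℂ)

/-- The spinors `σ₁, …, σₙ` over the polynomial ring. -/
def sigPoly : Particle m → Fin 2 → MvPolynomial (EvenVar m) ℂ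
  | Sum.inl a => fun A => MvPolynomial.C (τ a A)
  | Sum.inr i => fun A => MvPolynomial.X (EvenVar.sig i A)

/-- The product of all the denominators `(1i)`, `(2i)`, `(ξi)`, `(ij)` that are allowed. -/
def denom : MvPolynomial (EvenVar m) ℂ :=
  (∏ i : Fin m, br (sigPoly m τ (Sum.inl 0)) (sigPoly m τ (Sum.inr i)) *
      br (sigPoly m τ (Sum.inl 1)) (sigPoly m τ (Sum.inr i)) *
      br (fun A => MvPolynomial.C (ξ A)) (sigPoly m τ (Sum.inr i))) *
    ∏ p : Fin m × Fin m with p.1 < p.2,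
      br (sigPoly m τ (Sum.inr p.1)) (sigPoly m τ (Sum.inr p.2))

/-- The functions of the even variables: polynomial in `W`, `X`, rational in the `σᵢ` with poles
only where two of the spinors `σ₁, …, σₙ`, `ξ` become proportional. -/
abbrev EvenFun : Type := Localization (Submonoid.powers (denom m τ ξ))

/-- The Grassmann algebra of the odd variables. -/
abbrev Grass : Type := ExteriorAlgebra ℂ (OddVar m →₀ ℂ)

/-- The algebra of integrands. -/
abbrev Integrand : Type := EvenFun m τ ξ ⊗[ℂ] Grass m

/-- The centre of the algebra of integrands, a commutative ring that contains all its even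
elements. -/
abbrev Even : Type := Subalgebra.center ℂ (Integrand m τ ξ)

/-- An odd variable as an element of the Grassmann algebra. -/
def odd (v : OddVar m) : Grass m := ExteriorAlgebra.ι ℂ (Finsupp.single v 1)

theorem odd_mul_odd_comm (u v : OddVar m) (g : Grass m) :
    odd m u * odd m v * g = g * (odd m u * odd m v) := by
  have key : ∀ x y : OddVar m →₀ ℂ, ExteriorAlgebra.ι ℂ x * ExteriorAlgebra.ι ℂ y =
      -(ExteriorAlgebra.ι ℂ y * ExteriorAlgebra.ι ℂ x) := fun x y =>
    eq_neg_of_add_eq_zero_left (ExteriorAlgebra.ι_add_mul_swap x y)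
  induction g using ExteriorAlgebra.induction with
  | algebraMap r => exact (Algebra.commutes r _).symm
  | ι x =>
    rw [odd, odd, mul_assoc, key _ x, mul_neg, ← mul_assoc, key _ x, neg_mul, neg_neg, mul_assoc]
  | mul a b ha hb => rw [← mul_assoc, ha, mul_assoc, hb, mul_assoc]
  | add a b ha hb => rw [mul_add, ha, hb, add_mul]

variable {m τ ξ}

/-- A function of the even variables as an integrand. -/
def ev (f : EvenFun m τ ξ) : Even m τ ξ :=
  ⟨f ⊗ₜ[ℂ] 1, by
    rw [Subalgebra.mem_center_iff]
    intro b
    induction b using TensorProduct.induction_on with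
    | zero => simp
    | tmul x y => simp [Algebra.TensorProduct.tmul_mul_tmul, mul_comm]
    | add x y hx hy => rw [add_mul, mul_add, hx, hy]⟩

/-- The product of two odd variables as an integrand. -/
def oddProd (u v : OddVar m) : Even m τ ξ :=
  ⟨1 ⊗ₜ[ℂ] (odd m u * odd m v), by
    rw [Subalgebra.mem_center_iff]
    intro b
    induction b using TensorProduct.induction_on with
    | zero => simp
    | tmul x y => simp [Algebra.TensorProduct.tmul_mul_tmul, odd_mul_odd_comm]
    | add x y hx hy => rw [add_mul, mul_add, hx, hy]⟩

/-- An even variable as a function. -/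
def evar (v : EvenVar m) : EvenFun m τ ξ :=
  algebraMap (MvPolynomial (EvenVar m) ℂ) (EvenFun m τ ξ) (MvPolynomial.X v)

/-- The spinor `σᵢ`. -/
def sig (i : Particle m) (A : Fin 2) : EvenFun m τ ξ :=
  algebraMap (MvPolynomial (EvenVar m) ℂ) (EvenFun m τ ξ) (sigPoly m τ i A)

/-- A constant spinor. -/
def cst (ζ : Fin 2 → ℂ) (A : Fin 2) : EvenFun m τ ξ := algebraMap ℂ (EvenFun m τ ξ) (ζ A)

variable (m τ ξ)

/-- The exponent `i P · X`, where `P · X = ∑ᵢ Wᵢ · Z(σᵢ)` and `Z(σ) = X_A σ^A`. -/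
def expo : Even m τ ξ :=
  Complex.I • ∑ i : Particle m, ∑ A : Fin 2, ev (sig i A) *
    ((∑ α : Fin 4, ev (evar (EvenVar.W i α) * evar (EvenVar.X α A))) +
      ∑ a : Fin 4, oddProd (OddVar.W i a) (OddVar.X a A))

/-- The integration variables: the even and odd coordinates `X`, and the spinors `σᵢ` of the
particles other than `1, 2`. -/
inductive IntVar (m : ℕ) : Type
  | even (α : Fin 4) (A : Fin 2)
  | odd (a : Fin 4) (A : Fin 2)
  | sig (i : Fin m) (A : Fin 2)

/-- The partial derivative of a function of the even variables. -/
def evenDer (v : EvenVar m) : Derivation ℂ (EvenFun m τ ξ) (EvenFun m τ ξ) :=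
  locDer (Submonoid.powers (denom m τ ξ)) (MvPolynomial.pderiv v)

/-- The (left) partial derivative with respect to an integration variable. -/
def partialDer : IntVar m → (Integrand m τ ξ →ₗ[ℂ] Integrand m τ ξ)
  | IntVar.even α A =>
      LinearMap.rTensor (Grass m) (evenDer m τ ξ (EvenVar.X α A)).toLinearMap
  | IntVar.odd a A =>
      LinearMap.lTensor (EvenFun m τ ξ)
        (CliffordAlgebra.contractLeft (Q := (0 : QuadraticForm ℂ (OddVar m →₀ ℂ)))
          (Finsupp.lapply (OddVar.X a A)))
  | IntVar.sig i A =>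
      LinearMap.rTensor (Grass m) (evenDer m τ ξ (EvenVar.sig i A)).toLinearMap

/-- `F ↦ ∂F + ∂(i P · X) F`: the total derivative `∂ (F exp (i P · X))`, with the exponential
factored out. -/
def totalDer (v : IntVar m) : Integrand m τ ξ →ₗ[ℂ] Integrand m τ ξ :=
  partialDer m τ ξ v +
    LinearMap.mulLeft ℂ (partialDer m τ ξ v (expo m τ ξ : Integrand m τ ξ))

/-- The space of sums of total derivatives. -/
def totalDerivatives : Submodule ℂ (Integrand m τ ξ) :=
  ⨆ v : IntVar m, LinearMap.range (totalDer m τ ξ v)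

/-- Values of integrals: integrands modulo total derivatives. -/
abbrev IntegralValue : Type := Integrand m τ ξ ⧸ totalDerivatives m τ ξ

variable {m τ ξ}

/-- `∫ d^{8|8}X ∏ d²σᵢ / vol GL(2)` of `F exp (i P · X)`, with `σ₁, σ₂` fixed and with the
Faddeev-Popov factor `(12) ^ 2`. -/
def integral (F : Even m τ ξ) : IntegralValue m τ ξ :=
  (totalDerivatives m τ ξ).mkQ
    ((ev (br (sig (Sum.inl 0)) (sig (Sum.inl 1)) ^ 2) * F : Even m τ ξ) : Integrand m τ ξ)

end Integrands

/-! ### The infinity twistor and the ingredients of the amplitude -/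

/-- The bosonic part of `I_{IJ}`. -/
def infLower (Λ : ℂ) : Matrix (Fin 4) (Fin 4) ℂ :=
  !![0, 1, 0, 0; -1, 0, 0, 0; 0, 0, 0, Λ; 0, 0, -Λ, 0]

/-- The bosonic part of `I^{IJ}`. -/
def infUpper (Λ : ℂ) : Matrix (Fin 4) (Fin 4) ℂ :=
  !![0, -Λ, 0, 0; Λ, 0, 0, 0; 0, 0, 0, -1; 0, 0, 1, 0]

theorem infLower_mul_infUpper (Λ : ℂ) : infLower Λ * infUpper Λ = Λ • 1 := by
  ext i j
  fin_cases i <;> fin_cases j <;>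
    simp [infLower, infUpper, Matrix.mul_apply, Fin.sum_univ_four]

section Amplitude

variable {m : ℕ} {τ : Fin 2 → Fin 2 → ℂ} {ξ : Fin 2 → ℂ}

/-- `[Wᵢ, Wⱼ]`, the contraction with `I^{IJ}`.  The fermionic part has the sign for which
`I^{IJ}` is `Λ` times the graded inverse of `I_{IJ}`: if `W = ⟨C, ·⟩` and `W' = ⟨D, ·⟩`, then
`[W, W'] = - Λ ⟨C, D⟩` in the fermionic directions as in the bosonic ones. -/
def wbr (s : ℂ) (i j : Particle m) : Even m τ ξ :=
  (∑ α : Fin 4, ∑ β : Fin 4, infUpper (s ^ 2) α β •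
      ev (evar (EvenVar.W i α) * evar (EvenVar.W j β))) -
    s • ∑ a : Fin 4, oddProd (OddVar.W i a) (OddVar.W j a)

/-- `X²`, normalized by `⟨Z(σ), Z(σ')⟩ = X² (σ σ')`, so that `⟨Z, dZ⟩ = X² (σ dσ)`. -/
def xsq (s : ℂ) : Even m τ ξ :=
  (∑ α : Fin 4, ∑ β : Fin 4, infLower (s ^ 2) α β •
      ev (evar (EvenVar.X α 0) * evar (EvenVar.X β 1))) +
    s • ∑ a : Fin 4, oddProd (OddVar.X a 0) (OddVar.X a 1)

/-- The product `(ij)`. -/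
def sbr (i j : Particle m) : EvenFun m τ ξ := br (sig i) (sig j)

/-- The product `(ζ i)` with a constant spinor `ζ`. -/
def rbr (ζ : Fin 2 → ℂ) (i : Particle m) : EvenFun m τ ξ := br (cst ζ) (sig i)

/-- The off-diagonal entries `- [Wᵢ, Wⱼ] / (ij)` of the Hodges matrix. -/
def hodgesOff (s : ℂ) (i j : Particle m) : Even m τ ξ :=
  -(wbr s i j * ev (Ring.inverse (sbr i j)))

/-- The `n × n` Hodges matrix with reference spinor `ζ`. -/
def hodges (s : ℂ) (ζ : Fin 2 → ℂ) : Matrix (Particle m) (Particle m) (Even m τ ξ) :=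
  fun i j => if i = j then
      -∑ k ∈ Finset.univ.erase i,
        hodgesOff s i k * ev (rbr ζ k ^ 2 * Ring.inverse (rbr ζ i) ^ 2)
    else hodgesOff s i j

/-- The determinant of the Hodges matrix after removal of the rows and columns `1`, `2` and of
those in `T`. -/
def reduced (s : ℂ) (ζ : Fin 2 → ℂ) (T : Finset (Fin m)) : Even m τ ξ :=
  ((hodges s ζ).submatrix (fun i : {i : Fin m // i ∉ T} => Sum.inr i.1)
    (fun i : {i : Fin m // i ∉ T} => Sum.inr i.1)).det

/-- The determinant of the Hodges matrix after removal of the rows `1, 2, i` and the columns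
`1, 2, j`, with its sign as a cofactor. -/
def reducedOff (s : ℂ) (ζ : Fin 2 → ℂ) (i j : Fin m) : Even m τ ξ :=
  ((hodges s ζ).submatrix (fun i : Fin m => Sum.inr i)
    (fun i : Fin m => Sum.inr i)).adjugate j i

/-- The propagators `ω¹` (for `p = 0`) and `ω²` (for `p = 1`) to the contact structure. -/
def omega (s : ℂ) (p : Fin 2) (i j : Fin m) : Even m τ ξ :=
  s ^ 2 • (wbr s (Sum.inr i) (Sum.inr j) *
    ev (rbr ξ (Sum.inl p) ^ 4 * sbr (Sum.inr i) (Sum.inr j) *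
      Ring.inverse (sbr (Sum.inl p) (Sum.inr i)) ^ 2 *
      Ring.inverse (sbr (Sum.inl p) (Sum.inr j)) ^ 2 *
      Ring.inverse (rbr ξ (Sum.inr i)) ^ 2 * Ring.inverse (rbr ξ (Sum.inr j)) ^ 2))

/-- The term `∑ ω¹_{ij} ω²_{kl} |H^{12ijkl}_{12ijkl}|`, summed over pairwise distinct indices. -/
def omegaTerm (s : ℂ) : Even m τ ξ :=
  ∑ t : Fin 4 ↪ Fin m, omega s 0 (t 0) (t 1) * omega s 1 (t 2) (t 3) *
    reduced s ξ (Finset.univ.map t)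

/-- The factor `(12)² / ((1i) (1j) (2i) (2j))`. -/
def coeff (i j : Fin m) : Even m τ ξ :=
  ev (sbr (Sum.inl 0) (Sum.inl 1) ^ 2 *
    Ring.inverse (sbr (Sum.inl 0) (Sum.inr i)) * Ring.inverse (sbr (Sum.inl 0) (Sum.inr j)) *
    Ring.inverse (sbr (Sum.inl 1) (Sum.inr i)) * Ring.inverse (sbr (Sum.inl 1) (Sum.inr j)))

variable (m τ ξ)

/-- The MHV amplitude with cosmological constant `Λ = s ^ 2`. -/
def amplitude (s : ℂ) : IntegralValue m τ ξ :=
  (s ^ 2)⁻¹ • integral (xsq s ^ 2 * reduced s ξ ∅ + omegaTerm s)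

/-- The thrice-reduced form of the amplitude, with distinguished particle `i`. -/
def thriceReduced (s : ℂ) (i : Fin m) : IntegralValue m τ ξ :=
  integral ((-2 : ℂ) • (xsq s * coeff i i * reduced s ξ {i}) + (s ^ 2)⁻¹ • omegaTerm s)

/-- Hodges' formula (reference spinor `ζ`, distinguished particle `i`).  The factor `X²` at
`Λ = 0` does not involve the space-time coordinates: it is the determinant of the part of `X`
that can be set to the identity, instead of fixing `σ₁, σ₂`, and `X² = 1` then. -/
def hodgesAmplitude (ζ : Fin 2 → ℂ) (i : Fin m) : IntegralValue m τ ξ :=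
  integral (xsq 0 * coeff i i * reduced 0 ζ {i})

/-- The flat-space formula as a sum over all thrice-reduced determinants. -/
def flatSum (ζ : Fin 2 → ℂ) : IntegralValue m τ ξ :=
  integral (xsq 0 * (∑ i : Fin m, ∑ j : Fin m, coeff i j * reducedOff 0 ζ i j +
    ∑ i : Fin m, coeff i i * reduced 0 ζ {i}))

end Amplitude

end MHV

end

/-!
The vector field `[Wᵢ, ∂/∂X]` multiplies `e^{i P·X}` by the momentum contraction `[Wᵢ, P]`, and it
acts on `X²` as `Λ Wᵢ · X`, which is what `∂/∂σᵢ` brings down from the exponential. Two integrations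
by parts therefore trade a factor `[Wᵢ, P(η)]` against `(X²)²` for `Λ X²` times a divergence in the
`σᵢ`. The vector `vₖ = (1k)(2k)` is a null vector of the twice-reduced Hodges matrix up to such
momentum contractions, so its determinant is a combination of them with first minors as
coefficients. The second-order cofactors are symmetric, which makes the divergence of these minors
collapse to a single thrice-reduced determinant.

At `Λ = 0` the momentum contractions integrate to zero against `X²`, so that `v` is an honest null
vector and the adjugate is a multiple of `v vᵀ`, independent of the reference spinor.
-/

open scoped TensorProduct

noncomputable section

namespace MHV

section Matrix

open Matrix

variable {R A ι : Type*} [CommRing R] [CommRing A] [Algebra R A] [DecidableEq ι]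

theorem derivation_prod (D : Derivation R A A) (s : Finset ι) (f : ι → A) :
    D (∏ i ∈ s, f i) = ∑ i ∈ s, D (f i) * ∏ j ∈ s.erase i, f j := by
  induction s using Finset.induction_on with
  | empty => simp
  | insert a s ha ih =>
    rw [Finset.prod_insert ha, D.leibniz, ih, Finset.sum_insert ha, Finset.erase_insert ha,
      smul_eq_mul, smul_eq_mul, add_comm, mul_comm, Finset.mul_sum]
    congr 1
    refine Finset.sum_congr rfl fun i hi => ?_
    have hai : a ≠ i := fun h => ha (h ▸ hi)
    rw [Finset.erase_insert_of_ne hai, Finset.prod_insert fun h => ha (Finset.mem_of_mem_erase h)]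
    ring

variable [Fintype ι]

theorem derivation_det (D : Derivation R A A) (M : Matrix ι ι A) :
    D M.det = ∑ j, (M.updateRow j fun k => D (M j k)).det := by
  have expand (j : ι) : (M.updateRow j fun k => D (M j k)).det = ∑ σ : Equiv.Perm ι,
      (Equiv.Perm.sign σ : ℤ) • (D (M j (σ j)) * ∏ i ∈ Finset.univ.erase j, M i (σ i)) := by
    rw [← det_transpose, det_apply]
    refine Finset.sum_congr rfl fun σ _ => congrArg _ ?_
    rw [← Finset.mul_prod_erase _ _ (Finset.mem_univ j), transpose_apply, updateRow_self]
    exact congrArg _ (Finset.prod_congr rfl fun i hi => by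
      rw [transpose_apply, updateRow_ne (Finset.ne_of_mem_erase hi)])
  simp only [expand]
  rw [Finset.sum_comm, ← det_transpose, det_apply, map_sum]
  refine Finset.sum_congr rfl fun σ _ => ?_
  rw [← Finset.smul_sum, Units.smul_def, map_zsmul]
  exact congrArg _ (derivation_prod D _ _)

/-- The second-order cofactor of `M`: the determinant with the rows `i`, `j` replaced by the basis
vectors `k`, `l`. It is the coefficient with which row `j` enters the derivative of the cofactor
`M.adjugate k i`. -/
def cofactor₂ (M : Matrix ι ι A) (i j k l : ι) : A :=
  ((M.updateRow i (Pi.single k 1)).updateRow j (Pi.single l 1)).det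

theorem cofactor₂_eq_adjugate (M : Matrix ι ι A) {i j : ι} (hij : i ≠ j) (k l : ι) :
    cofactor₂ M i j k l = (M.updateRow j (Pi.single l 1)).adjugate k i := by
  rw [adjugate_apply, updateRow_comm _ hij.symm, cofactor₂]

theorem cofactor₂_swap_rows (M : Matrix ι ι A) {i j : ι} (hij : i ≠ j) (k l : ι) :
    cofactor₂ M j i k l = -cofactor₂ M i j k l := by
  have hswap : ((M.updateRow i (Pi.single k 1)).updateRow j (Pi.single l 1)).submatrix
      (Equiv.swap i j) id = (M.updateRow j (Pi.single k 1)).updateRow i (Pi.single l 1) := by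
    ext a b
    rcases eq_or_ne a i with rfl | hai
    · simp
    rcases eq_or_ne a j with rfl | haj
    · simp [hij, hij.symm]
    · simp [Equiv.swap_apply_of_ne_of_ne hai haj, hai, haj]
  rw [cofactor₂, ← hswap, det_permute, Equiv.Perm.sign_swap hij, cofactor₂]
  simp

theorem sum_erase_mul_cofactor₂ (M : Matrix ι ι A) (j k : ι) :
    ∑ i ∈ Finset.univ.erase j, M i j * cofactor₂ M i j k j =
      (Pi.single j (M.adjugate j j) : ι → A) k - M.adjugate k j := by
  set N := M.updateRow j (Pi.single j 1) with hN
  have hNk : N.adjugate k j = M.adjugate k j := by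
    rw [adjugate_apply, adjugate_apply, hN, updateRow_idem]
  have hdet : N.det = M.adjugate j j := (adjugate_apply M j j).symm
  have hsum : ∑ i, N.adjugate k i * N i j = (Pi.single j (M.adjugate j j) : ι → A) k := by
    rw [← mul_apply, adjugate_mul, Matrix.smul_apply, hdet, one_apply, Pi.single_apply]
    simp
  rw [← hsum, ← Finset.add_sum_erase _ _ (Finset.mem_univ j), hNk, hN, updateRow_self,
    Pi.single_eq_same, mul_one, add_sub_cancel_left]
  refine Finset.sum_congr rfl fun i hi => ?_
  have hij := Finset.ne_of_mem_erase hi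
  rw [cofactor₂_eq_adjugate M hij, updateRow_ne hij, mul_comm]

/-- Only the entries of row `j` in the columns `i` and `j` contribute. -/
theorem derivation_adjugate (M : Matrix ι ι A) (D : Derivation R A A) (i k : ι)
    (hD : ∀ j l, j ≠ i → l ≠ i → j ≠ l → D (M j l) = 0) :
    D (M.adjugate k i) = ∑ j ∈ Finset.univ.erase i,
      (D (M j i) * cofactor₂ M i j k i + D (M j j) * cofactor₂ M i j k j) := by
  rw [adjugate_apply, derivation_det, ← Finset.add_sum_erase _ _ (Finset.mem_univ i),
    det_eq_zero_of_row_eq_zero i fun l => ?_, zero_add]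
  · refine Finset.sum_congr rfl fun j hj => ?_
    have hji := Finset.ne_of_mem_erase hj
    have hrow : (fun l => D (M.updateRow i (Pi.single k 1) j l)) =
        D (M j i) • Pi.single i 1 + D (M j j) • Pi.single j 1 := by
      ext l
      rw [updateRow_ne hji]
      rcases eq_or_ne l i with rfl | hli
      · simp [hji.symm]
      rcases eq_or_ne l j with rfl | hlj
      · simp [hji]
      · simp [hli, hlj, hD j l hji hli hlj.symm]
    rw [hrow, det_updateRow_add, det_updateRow_smul, det_updateRow_smul, cofactor₂, cofactor₂]
  · rw [updateRow_self, updateRow_self, Pi.single_apply]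
    split_ifs <;> simp

theorem sum_sum_erase_eq_zero_of_antisymm {f : ι → ι → A} (hf : ∀ i j, i ≠ j → f i j = -f j i) :
    ∑ i, ∑ j ∈ Finset.univ.erase i, f i j = 0 := by
  rw [Finset.sum_sigma']
  refine Finset.sum_involution (fun p _ => ⟨p.2, p.1⟩) (fun p hp => ?_) (fun p hp _ => ?_)
    (fun p hp => ?_) (fun _ _ => rfl)
  all_goals
    have hne : p.2 ≠ p.1 := by simpa using hp
  · rw [hf _ _ hne, add_neg_cancel]
  · exact fun h => hne (congrArg Sigma.fst h)
  · simpa using hne.symm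

/-- The terms in which `δ i` meets the entry `M i j` cancel against those in which `δ j` meets it,
because second-order cofactors change sign when the two rows are exchanged. -/
theorem sum_derivation_adjugate {M : Matrix ι ι A} (hM : M.IsSymm) {δ : ι → Derivation R A A}
    {u : ι → A} {b : A} (h0 : ∀ i j k, j ≠ i → k ≠ i → j ≠ k → δ i (M j k) = 0)
    (hoff : ∀ i j, i ≠ j → δ i (M i j) = -δ j (M i j))
    (hdiag : ∀ i j, i ≠ j → u i * δ i (M j j) = (b * M i j - δ i (M i j)) * u j) (k : ι) :
    ∑ i, u i * δ i (M.adjugate k i) + b * ∑ i, u i * M.adjugate k i =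
      b * (u k * M.adjugate k k) := by
  have hcancel : ∑ i, ∑ j ∈ Finset.univ.erase i,
      δ i (M i j) * (u i * cofactor₂ M i j k i - u j * cofactor₂ M i j k j) = 0 :=
    sum_sum_erase_eq_zero_of_antisymm fun i j hij => by
      rw [hM.apply i j, cofactor₂_swap_rows M hij, cofactor₂_swap_rows M hij, hoff i j hij]
      ring
  have hsplit : ∑ i, u i * δ i (M.adjugate k i) =
      ∑ i, ∑ j ∈ Finset.univ.erase i, b * u j * (M i j * cofactor₂ M i j k j) := by
    rw [← add_zero (∑ i, ∑ j ∈ _, _), ← hcancel, ← Finset.sum_add_distrib]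
    refine Finset.sum_congr rfl fun i _ => ?_
    rw [derivation_adjugate M (δ i) i k (h0 i), Finset.mul_sum, ← Finset.sum_add_distrib]
    refine Finset.sum_congr rfl fun j hj => ?_
    have hij := (Finset.ne_of_mem_erase hj).symm
    rw [hM.apply i j]
    linear_combination cofactor₂ M i j k j * hdiag i j hij
  have hcomm : ∑ i, ∑ j ∈ Finset.univ.erase i, b * u j * (M i j * cofactor₂ M i j k j) =
      ∑ j, b * u j * ((Pi.single j (M.adjugate j j) : ι → A) k - M.adjugate k j) := by
    rw [Finset.sum_comm' (t' := Finset.univ) (s' := fun j => Finset.univ.erase j)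
      (by simp [ne_comm])]
    exact Finset.sum_congr rfl fun j _ => by rw [← Finset.mul_sum, sum_erase_mul_cofactor₂]
  rw [hsplit, hcomm]
  simp only [mul_sub, Finset.sum_sub_distrib, Pi.single_apply, mul_ite, mul_zero,
    Finset.sum_ite_eq, Finset.mem_univ, if_true, mul_assoc, ← Finset.mul_sum]
  ring

theorem det_submatrix_notMem_singleton (M : Matrix ι ι A) (i : ι) :
    (M.submatrix (fun j : {j // j ∉ ({i} : Finset ι)} => j.1)
      (fun j : {j // j ∉ ({i} : Finset ι)} => j.1)).det = M.adjugate i i := by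
  have hmem (j : {j // ¬ j ∉ ({i} : Finset ι)}) : j.1 = i := by simpa using j.2
  have : Unique {j // ¬ j ∉ ({i} : Finset ι)} :=
    ⟨⟨⟨i, by simp⟩⟩, fun j => Subtype.ext (hmem j)⟩
  rw [adjugate_apply, twoBlockTriangular_det _ fun j => j ∉ ({i} : Finset ι),
    det_unique (n := {j // ¬ j ∉ ({i} : Finset ι)}), toSquareBlockProp_def, toSquareBlockProp_def,
    of_apply, hmem, updateRow_self, Pi.single_eq_same, mul_one]
  · congr 1
    ext a b
    exact (congrFun (updateRow_ne (by simpa using a.2)) b.1).symm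
  · intro a ha b hb
    obtain rfl : a = i := hmem ⟨a, ha⟩
    rw [updateRow_self, Pi.single_eq_of_ne (by simpa using hb)]

theorem det_mem {S : Type*} [SetLike S A] [SubringClass S A] {s : S} {M : Matrix ι ι A}
    (hM : ∀ i j, M i j ∈ s) : M.det ∈ s := by
  rw [det_apply]
  exact sum_mem fun σ _ => zsmul_mem (prod_mem fun i _ => hM _ _) _

theorem adjugate_mem {S : Type*} [SetLike S A] [SubringClass S A] {s : S} {M : Matrix ι ι A}
    (hM : ∀ i j, M i j ∈ s) (k l : ι) : M.adjugate k l ∈ s := by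
  rw [adjugate_apply]
  refine det_mem fun i j => ?_
  rw [updateRow_apply, Pi.single_apply]
  split_ifs
  exacts [one_mem s, zero_mem s, hM i j]

theorem adjugate_mul_apply_of_mulVec_eq_zero {M : Matrix ι ι A} {v : ι → A} (h : M *ᵥ v = 0)
    (a b i : ι) : M.adjugate a i * v b = v a * M.adjugate b i := by
  set N := M.updateRow i (Pi.single a 1) with hN
  have hNv : N *ᵥ v = Pi.single i (v a) := by
    ext j
    rcases eq_or_ne j i with rfl | hj
    · simp [hN, mulVec]
    · simpa [hN, mulVec, updateRow_ne hj, hj] using congrFun h j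
  have hb : N.adjugate b i = M.adjugate b i := by
    rw [adjugate_apply, adjugate_apply, hN, updateRow_idem]
  have hdet : N.det * v b = N.adjugate b i * v a := by
    have := congrFun (congrArg (N.adjugate *ᵥ ·) hNv) b
    simpa [mulVec_mulVec, adjugate_mul, smul_mulVec] using this
  rw [adjugate_apply M a i, ← hN, hdet, hb, mul_comm]

theorem adjugate_mul_mul_of_mulVec_eq_zero {M : Matrix ι ι A} (hM : M.IsSymm) {v : ι → A}
    (h : M *ᵥ v = 0) (a b c d : ι) :
    M.adjugate a b * (v c * v d) = M.adjugate c d * (v a * v b) := by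
  have hac := adjugate_mul_apply_of_mulVec_eq_zero h a c b
  have hbd := adjugate_mul_apply_of_mulVec_eq_zero h b d c
  rw [hM.adjugate.apply c b, hM.adjugate.apply c d] at hbd
  linear_combination v d * hac + v a * hbd

theorem adjugate_normalized_eq {M : Matrix ι ι A} (hM : M.IsSymm) {v w : ι → A}
    (h : M *ᵥ v = 0) (hvw : ∀ i, v i * w i = 1) (a b c d : ι) :
    w a * w b * M.adjugate a b = w c * w d * M.adjugate c d :=
  calc w a * w b * M.adjugate a b = w a * w b * M.adjugate a b * ((v c * w c) * (v d * w d)) := by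
        rw [hvw, hvw, mul_one, mul_one]
    _ = w c * w d * M.adjugate c d * ((v a * w a) * (v b * w b)) := by
        linear_combination
          w a * w b * w c * w d * adjugate_mul_mul_of_mulVec_eq_zero hM h a b c d
    _ = w c * w d * M.adjugate c d := by rw [hvw, hvw, mul_one, mul_one]

omit [DecidableEq ι] in
theorem eq_of_mulVec_eq_of_isUnit {M M' : Matrix ι ι A} {v : ι → A} (hv : ∀ i, IsUnit (v i))
    (hoff : ∀ i j, i ≠ j → M i j = M' i j) (h : M *ᵥ v = M' *ᵥ v) : M = M' := by
  classical
  ext i j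
  rcases eq_or_ne i j with rfl | hij
  · have hi := congrFun h i
    simp only [mulVec, dotProduct] at hi
    rw [← Finset.add_sum_erase _ _ (Finset.mem_univ i),
      ← Finset.add_sum_erase _ (fun j => M' i j * v j) (Finset.mem_univ i),
      Finset.sum_congr rfl fun j hj => by rw [hoff i j (Finset.ne_of_mem_erase hj).symm]] at hi
    exact (hv i).mul_right_cancel (add_right_cancel hi)
  · exact hoff i j hij

/-- Modulo `J` the two matrices coincide and have the null vector `v`, so that their adjugate is a
multiple of `v vᵀ`. -/
theorem adjugate_normalized_sub_mem (J : Ideal A) {M M' : Matrix ι ι A} {v w : ι → A}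
    (hM : M.IsSymm) (hoff : ∀ i j, i ≠ j → M i j = M' i j) (hvw : ∀ i, v i * w i = 1)
    (hMv : ∀ i, (M *ᵥ v) i ∈ J) (hMv' : ∀ i, (M' *ᵥ v) i ∈ J) (a b c d : ι) :
    w a * w b * M.adjugate a b - w c * w d * M'.adjugate c d ∈ J := by
  let q := Ideal.Quotient.mk J
  have hnull {L : Matrix ι ι A} (hL : ∀ i, (L *ᵥ v) i ∈ J) : q.mapMatrix L *ᵥ (q ∘ v) = 0 := by
    ext i
    rw [RingHom.mapMatrix_apply, ← RingHom.map_mulVec]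
    exact Ideal.Quotient.eq_zero_iff_mem.2 (hL i)
  have hqvw (i : ι) : q (v i) * q (w i) = 1 := by rw [← map_mul, hvw, map_one]
  have hMM' : q.mapMatrix M = q.mapMatrix M' :=
    eq_of_mulVec_eq_of_isUnit (fun i => .of_mul_eq_one _ (hqvw i))
      (fun i j hij => congrArg q (hoff i j hij)) ((hnull hMv).trans (hnull hMv').symm)
  have hadj (L : Matrix ι ι A) (i j : ι) : q (L.adjugate i j) = (q.mapMatrix L).adjugate i j := by
    rw [← RingHom.map_adjugate]
    rfl
  have heq := adjugate_normalized_eq (hM.map q) (hnull hMv) hqvw a b c d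
  rw [← RingHom.mapMatrix_apply, ← hadj, hMM', ← hadj] at heq
  refine Ideal.Quotient.eq.1 ?_
  simpa only [map_mul] using heq

end Matrix

section PolynomialDependence

variable {k R : Type*} [CommRing k] [CommRing R] [Algebra k R]

/-- `f s` is given by a polynomial in the scalar `s`, with coefficients in `R`. -/
def IsPolyIn (f : k → R) : Prop :=
  ∃ p : Polynomial R, ∀ s, f s = p.eval (algebraMap k R s)

theorem IsPolyIn.const (x : R) : IsPolyIn fun _ : k => x := ⟨Polynomial.C x, fun s => by simp⟩

theorem isPolyIn_pow (n : ℕ) : IsPolyIn fun s : k => s ^ n := ⟨Polynomial.X ^ n, fun s => by simp⟩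

theorem isPolyIn_id : IsPolyIn fun s : k => s := ⟨Polynomial.X, fun s => by simp⟩

theorem IsPolyIn.add {f g : k → R} (hf : IsPolyIn f) (hg : IsPolyIn g) :
    IsPolyIn fun s => f s + g s := by
  obtain ⟨p, hp⟩ := hf
  obtain ⟨q, hq⟩ := hg
  exact ⟨p + q, fun s => by simp only [hp, hq, Polynomial.eval_add]⟩

theorem IsPolyIn.mul {f g : k → R} (hf : IsPolyIn f) (hg : IsPolyIn g) :
    IsPolyIn fun s => f s * g s := by
  obtain ⟨p, hp⟩ := hf
  obtain ⟨q, hq⟩ := hg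
  exact ⟨p * q, fun s => by simp only [hp, hq, Polynomial.eval_mul]⟩

theorem IsPolyIn.neg {f : k → R} (hf : IsPolyIn f) : IsPolyIn fun s => -f s := by
  obtain ⟨p, hp⟩ := hf
  exact ⟨-p, fun s => by simp only [hp, Polynomial.eval_neg]⟩

theorem IsPolyIn.sub {f g : k → R} (hf : IsPolyIn f) (hg : IsPolyIn g) :
    IsPolyIn fun s => f s - g s := by
  simpa only [sub_eq_add_neg] using hf.add hg.neg

theorem IsPolyIn.sum {κ : Type*} (t : Finset κ) {f : κ → k → R}
    (hf : ∀ i, IsPolyIn (f i)) : IsPolyIn fun s => ∑ i ∈ t, f i s := by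
  choose p hp using hf
  exact ⟨∑ i ∈ t, p i, fun s => by simp only [hp, Polynomial.eval_finsetSum]⟩

theorem IsPolyIn.smul {c : k → k} {f : k → R} (hc : IsPolyIn c) (hf : IsPolyIn f) :
    IsPolyIn fun s => c s • f s := by
  obtain ⟨p, hp⟩ := hc
  obtain ⟨q, hq⟩ := hf
  refine ⟨p.map (algebraMap k R) * q, fun s => ?_⟩
  beta_reduce
  rw [hp, hq, Polynomial.eval_mul, Polynomial.eval_map, Polynomial.eval₂_at_apply,
    Algebra.smul_def]
  rfl

theorem IsPolyIn.det {κ : Type*} [Fintype κ] [DecidableEq κ] {M : k → Matrix κ κ R}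
    (hM : ∀ i j, IsPolyIn fun s => M s i j) : IsPolyIn fun s => (M s).det := by
  choose p hp using hM
  refine ⟨(Matrix.of p).det, fun s => ?_⟩
  rw [← Polynomial.coe_evalRingHom, RingHom.map_det]
  exact congrArg Matrix.det (Matrix.ext fun i j => hp i j s)

theorem IsPolyIn.exists_eq_sum_pow_smul {V : Type*} [AddCommGroup V] [Module k V] {f : k → R}
    (hf : IsPolyIn f) (φ : R →ₗ[k] V) :
    ∃ c : ℕ →₀ V, (∀ s, φ (f s) = c.sum fun d v => s ^ d • v) ∧ c 0 = φ (f 0) := by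
  obtain ⟨p, hp⟩ := hf
  refine ⟨Finsupp.onFinset p.support (fun d => φ (p.coeff d)) fun d hd => ?_, fun s => ?_, ?_⟩
  · exact Polynomial.mem_support_iff.2 fun h0 => hd (by rw [h0, map_zero])
  · rw [Finsupp.onFinset_sum _ fun d => smul_zero _, hp, Polynomial.eval_eq_sum,
      Polynomial.sum, map_sum]
    refine Finset.sum_congr rfl fun d _ => ?_
    rw [← map_pow, mul_comm, ← Algebra.smul_def, map_smul]
  · rw [Finsupp.onFinset_apply, hp, map_zero, ← Polynomial.coeff_zero_eq_eval_zero]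

end PolynomialDependence

section Leibniz

variable {R A B : Type*} [CommRing R] [Ring A] [Algebra R A] [Ring B] [Algebra R B]

/-- The Leibniz rule on an algebra that need not be commutative, where `Derivation` is not
available. -/
def IsLeibniz (δ : A →ₗ[R] A) : Prop := ∀ x y, δ (x * y) = δ x * y + x * δ y

theorem IsLeibniz.add {δ ε : A →ₗ[R] A} (hδ : IsLeibniz δ) (hε : IsLeibniz ε) :
    IsLeibniz (δ + ε) := fun x y => by
  simp only [LinearMap.add_apply, hδ x y, hε x y, add_mul, mul_add]
  abel

theorem IsLeibniz.sum {ι : Type*} {s : Finset ι} {δ : ι → A →ₗ[R] A}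
    (hδ : ∀ i ∈ s, IsLeibniz (δ i)) : IsLeibniz (∑ i ∈ s, δ i) :=
  Finset.sum_induction _ IsLeibniz (fun _ _ => IsLeibniz.add) (fun x y => by simp) hδ

theorem IsLeibniz.smul {δ : A →ₗ[R] A} (hδ : IsLeibniz δ) (c : R) : IsLeibniz (c • δ) :=
  fun x y => by simp [hδ x y]

theorem IsLeibniz.rTensor {δ : A →ₗ[R] A} (hδ : IsLeibniz δ) : IsLeibniz (δ.rTensor B) := by
  intro x y
  induction x with
  | zero => simp
  | add x x' hx hx' => rw [add_mul, map_add, hx, hx', map_add]; noncomm_ring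
  | tmul a b =>
    induction y with
    | zero => simp
    | add y y' hy hy' => rw [mul_add, map_add, hy, hy', map_add]; noncomm_ring
    | tmul a' b' =>
      simp [Algebra.TensorProduct.tmul_mul_tmul, hδ a a', TensorProduct.add_tmul]

theorem IsLeibniz.lTensor {δ : B →ₗ[R] B} (hδ : IsLeibniz δ) : IsLeibniz (δ.lTensor A) := by
  intro x y
  induction x with
  | zero => simp
  | add x x' hx hx' => rw [add_mul, map_add, hx, hx', map_add]; noncomm_ring
  | tmul a b =>
    induction y with
    | zero => simp
    | add y y' hy hy' => rw [mul_add, map_add, hy, hy', map_add]; noncomm_ring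
    | tmul a' b' =>
      simp [Algebra.TensorProduct.tmul_mul_tmul, hδ b b', TensorProduct.tmul_add]

theorem IsLeibniz.mem_center {δ : A →ₗ[R] A} (hδ : IsLeibniz δ) {z : A}
    (hz : z ∈ Subalgebra.center R A) : δ z ∈ Subalgebra.center R A := by
  rw [Subalgebra.mem_center_iff] at hz ⊢
  intro x
  have h := congrArg δ (hz x)
  rw [hδ, hδ, hz, add_comm] at h
  exact add_right_cancel h

/-- The derivation of the centre induced by a linear map that satisfies the Leibniz rule. -/
def IsLeibniz.centerDerivation {δ : A →ₗ[R] A} (hδ : IsLeibniz δ) :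
    Derivation R (Subalgebra.center R A) (Subalgebra.center R A) :=
  Derivation.mk' ((δ ∘ₗ (Subalgebra.center R A).val.toLinearMap).codRestrict
      (Subalgebra.toSubmodule (Subalgebra.center R A)) fun z => hδ.mem_center z.2) fun x y =>
    Subtype.ext <| by
      have h := hδ x.1 y.1
      rw [Subalgebra.mem_center_iff.1 y.2 (δ x), add_comm] at h
      exact h

end Leibniz

section Grassmann

open CliffordAlgebra

variable {R M : Type*} [CommRing R] [AddCommGroup M] [Module R M] {Q : QuadraticForm R M}

theorem contractLeft_mul_of_contractLeft_eq_zero {d : Module.Dual R M} {y : CliffordAlgebra Q}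
    (hy : contractLeft d y = 0) (x : CliffordAlgebra Q) :
    contractLeft d (x * y) = contractLeft d x * y := by
  induction x using left_induction with
  | algebraMap r => simp [contractLeft_algebraMap_mul, hy]
  | add x x' hx hx' => rw [add_mul, map_add, hx, hx', map_add, add_mul]
  | ι_mul x v hx =>
    rw [mul_assoc, contractLeft_ι_mul, contractLeft_ι_mul, hx, sub_mul, smul_mul_assoc, mul_assoc]

/-- An odd coefficient makes the odd derivative `d⌋` even, which turns the graded Leibniz rule into
the ordinary one. -/
theorem isLeibniz_mulLeft_comp_contractLeft (v : M) (d : Module.Dual R M) :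
    IsLeibniz (LinearMap.mulLeft R (ExteriorAlgebra.ι R v) ∘ₗ
      contractLeft (Q := (0 : QuadraticForm R M)) d) := by
  intro x
  induction x using ExteriorAlgebra.induction with
  | algebraMap r =>
    intro y
    simp [contractLeft_algebraMap, ← Algebra.smul_def]
  | ι u =>
    intro y
    have hswap := eq_neg_of_add_eq_zero_left (ExteriorAlgebra.ι_add_mul_swap (R := R) v u)
    have hι (z : ExteriorAlgebra R M) : contractLeft (Q := (0 : QuadraticForm R M)) d
        (ExteriorAlgebra.ι R u * z) = d u • z - ExteriorAlgebra.ι R u * contractLeft d z :=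
      contractLeft_ι_mul _ u z
    have hu : contractLeft (Q := (0 : QuadraticForm R M)) d (ExteriorAlgebra.ι R u) =
        algebraMap R _ (d u) := contractLeft_ι _ _ u
    simp only [LinearMap.comp_apply, LinearMap.mulLeft_apply, hι, hu, mul_sub, ← mul_assoc, hswap,
      ← Algebra.commutes, ← Algebra.smul_def, mul_smul_comm, smul_mul_assoc, neg_mul,
      sub_neg_eq_add]
  | mul x x' hx hx' =>
    intro y
    rw [mul_assoc, hx, hx', hx]
    noncomm_ring
  | add x x' hx hx' =>
    intro y
    rw [add_mul, map_add, hx, hx', map_add]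
    noncomm_ring

end Grassmann

section Constants

variable {R A ι : Type*} [CommRing R] [CommRing A] [Algebra R A]

/-- The elements annihilated by every derivation of a family. -/
def constants (δ : ι → Derivation R A A) : Subalgebra R A where
  carrier := {a | ∀ i, δ i a = 0}
  add_mem' ha hb i := by rw [map_add, ha i, hb i, add_zero]
  mul_mem' ha hb i := by rw [Derivation.leibniz, ha i, hb i, smul_zero, smul_zero, add_zero]
  algebraMap_mem' r i := (δ i).map_algebraMap r

theorem derivation_ringInverse (D : Derivation R A A) {f : A} (hf : IsUnit f) :
    D (Ring.inverse f) = -(Ring.inverse f ^ 2 * D f) := by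
  rw [Derivation.leibniz_of_mul_eq_one _ (Ring.inverse_mul_cancel f hf), smul_eq_mul, neg_mul]

theorem ringInverse_mem_constants {δ : ι → Derivation R A A} {a : A} (ha : a ∈ constants δ) :
    Ring.inverse a ∈ constants δ := by
  by_cases h : IsUnit a
  · intro i
    rw [derivation_ringInverse _ h, ha i, mul_zero, neg_zero]
  · rw [Ring.inverse_non_unit a h]
    exact zero_mem _

end Constants

section Spinors

variable {R A : Type*} [CommRing R] [CommRing A] [Algebra R A]

theorem br_self (u : Fin 2 → A) : br u u = 0 := by
  simp only [br]; ring

theorem br_swap (u v : Fin 2 → A) : br u v = -br v u := by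
  simp only [br]; ring

theorem br_zero_left (v : Fin 2 → A) : br (fun _ => 0) v = 0 := by
  simp [br]

theorem br_zero_right (v : Fin 2 → A) : br v (fun _ => 0) = 0 := by
  simp [br]

theorem derivation_br (D : Derivation R A A) (u v : Fin 2 → A) :
    D (br u v) = br (fun k => D (u k)) v + br u fun k => D (v k) := by
  simp only [br, map_sub, Derivation.leibniz, smul_eq_mul]
  ring

/-- The coefficient `(pζ)(qx) + (qζ)(px)` of `ζ` in `etaSpinor`. -/
def etaCoeff (p q z x : Fin 2 → A) : A := br p z * br q x + br q z * br p x

/-- The spinor `((pζ)(qx) + (qζ)(px)) ζ - (pζ)(qζ) x`, which measures by how much the rows of the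
Hodges matrix fail to annihilate the vector `(pk)(qk)`; see `br_mul_br_etaSpinor`. -/
def etaSpinor (p q z x : Fin 2 → A) : Fin 2 → A :=
  fun k => etaCoeff p q z x * z k - br p z * br q z * x k

theorem br_etaSpinor_self (p q z x : Fin 2 → A) :
    br z (etaSpinor p q z x) = -(br p z * br q z * br z x) := by
  simp only [br, etaSpinor]; ring

theorem br_etaSpinor_add_br_etaSpinor (p q z x y : Fin 2 → A) :
    br (etaSpinor p q z x) y + br x (etaSpinor p q z y) = 0 := by
  simp only [br, etaSpinor, etaCoeff]; ring

theorem br_mul_br_etaSpinor (p q z x y : Fin 2 → A) :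
    br x y * br (etaSpinor p q z x) y =
      br p x * br q x * br z y ^ 2 - br p y * br q y * br z x ^ 2 := by
  simp only [br, etaSpinor, etaCoeff]; ring

theorem br_mul_br_etaSpinor_add (p q z x : Fin 2 → A) :
    br p x * br q (etaSpinor p q z x) + br q x * br p (etaSpinor p q z x) =
      2 * (br p z * br q z) * (br p x * br q x) + br p q ^ 2 * br z x ^ 2 := by
  simp only [br, etaSpinor, etaCoeff]; ring

end Spinors

section Integrand

variable {m : ℕ} {τ : Fin 2 → Fin 2 → ℂ} {ξ : Fin 2 → ℂ}

-- Without these shortcuts the algebraic structure of `Even` is searched for through the centre of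
-- the tensor product, which is too slow for `ring` and `rw`.
local instance evenCommRing : CommRing (Even m τ ξ) := inferInstance
local instance evenRing : Ring (Even m τ ξ) := evenCommRing.toRing
local instance evenAddCommGroup : AddCommGroup (Even m τ ξ) :=
  evenCommRing.toRing.toAddCommGroup
local instance evenCommSemiring : CommSemiring (Even m τ ξ) :=
  evenCommRing.toCommSemiring
local instance evenNonAssocRing : NonAssocRing (Even m τ ξ) :=
  evenCommRing.toNonAssocRing
local instance evenNeg : Neg (Even m τ ξ) := evenCommRing.toNeg
local instance evenSub : Sub (Even m τ ξ) := evenCommRing.toSub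

/-- `ev` as an algebra homomorphism. -/
def evHom : EvenFun m τ ξ →ₐ[ℂ] Even m τ ξ :=
  Algebra.TensorProduct.includeLeft.codRestrict _ fun f => (ev f).2

theorem ev_add (f g : EvenFun m τ ξ) : ev (f + g) = ev f + ev g := map_add evHom f g
theorem ev_sub (f g : EvenFun m τ ξ) : ev (f - g) = ev f - ev g := map_sub evHom f g
theorem ev_neg (f : EvenFun m τ ξ) : ev (-f) = -ev f := map_neg evHom f
theorem ev_mul (f g : EvenFun m τ ξ) : ev (f * g) = ev f * ev g := map_mul evHom f g
theorem ev_pow (f : EvenFun m τ ξ) (n : ℕ) : ev (f ^ n) = ev f ^ n := map_pow evHom f n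
theorem ev_smul (c : ℂ) (f : EvenFun m τ ξ) : ev (c • f) = c • ev f := map_smul evHom c f
theorem ev_zero : ev (0 : EvenFun m τ ξ) = 0 := map_zero evHom
theorem ev_one : ev (1 : EvenFun m τ ξ) = 1 := map_one evHom

theorem evenDer_evar [DecidableEq (EvenVar m)] (v w : EvenVar m) :
    evenDer m τ ξ v (evar w) = if w = v then 1 else 0 := by
  rw [evar, evenDer, locDer_algebraMap, MvPolynomial.pderiv_X, Pi.single_apply]
  split_ifs <;> simp_all

theorem evenDer_evar_of_ne {v w : EvenVar m} (h : w ≠ v) : evenDer m τ ξ v (evar w) = 0 := by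
  classical
  rw [evenDer_evar, if_neg h]

theorem sig_inr (i : Fin m) (A : Fin 2) :
    (sig (Sum.inr i) A : EvenFun m τ ξ) = evar (EvenVar.sig i A) := rfl

theorem sig_inl (a : Fin 2) (A : Fin 2) :
    (sig (Sum.inl a) A : EvenFun m τ ξ) = cst (τ a) A := by
  rw [sig, sigPoly, cst, IsScalarTower.algebraMap_apply ℂ (MvPolynomial (EvenVar m) ℂ)]; rfl

theorem evenDer_cst (v : EvenVar m) (ζ : Fin 2 → ℂ) (A : Fin 2) :
    evenDer m τ ξ v (cst ζ A) = 0 :=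
  Derivation.map_algebraMap _ _

theorem evenDer_sig_sig (i j : Fin m) (A B : Fin 2) :
    evenDer m τ ξ (EvenVar.sig i A) (sig (Sum.inr j) B) = if j = i ∧ B = A then 1 else 0 := by
  classical
  rw [sig_inr, evenDer_evar]
  simp

theorem evenDer_sig_inl (i : Fin m) (A B : Fin 2) (a : Fin 2) :
    evenDer m τ ξ (EvenVar.sig i A) (sig (Sum.inl a) B) = 0 := by
  rw [sig_inl, evenDer_cst]

/-- The functions that do not depend on `X`. -/
def xFreeFun (m : ℕ) (τ : Fin 2 → Fin 2 → ℂ) (ξ : Fin 2 → ℂ) : Subalgebra ℂ (EvenFun m τ ξ) :=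
  constants fun v : Fin 4 × Fin 2 => evenDer m τ ξ (EvenVar.X v.1 v.2)

theorem cst_mem_xFreeFun (ζ : Fin 2 → ℂ) (A : Fin 2) : cst ζ A ∈ xFreeFun m τ ξ :=
  Subalgebra.algebraMap_mem _ _

theorem sig_mem_xFreeFun (i : Particle m) (A : Fin 2) : sig i A ∈ xFreeFun m τ ξ := by
  rcases i with a | i
  · rw [sig_inl]
    exact cst_mem_xFreeFun _ _
  · exact fun _ => evenDer_evar_of_ne (by simp)

theorem evar_W_mem_xFreeFun (i : Particle m) (α : Fin 4) :
    evar (EvenVar.W i α) ∈ xFreeFun m τ ξ :=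
  fun _ => evenDer_evar_of_ne (by simp)

theorem br_mem_xFreeFun {u v : Fin 2 → EvenFun m τ ξ} (hu : ∀ A, u A ∈ xFreeFun m τ ξ)
    (hv : ∀ A, v A ∈ xFreeFun m τ ξ) : br u v ∈ xFreeFun m τ ξ :=
  sub_mem (mul_mem (hu 0) (hv 1)) (mul_mem (hu 1) (hv 0))

theorem sbr_mem_xFreeFun (i j : Particle m) : sbr i j ∈ xFreeFun m τ ξ :=
  br_mem_xFreeFun (sig_mem_xFreeFun i) (sig_mem_xFreeFun j)

theorem rbr_mem_xFreeFun (ζ : Fin 2 → ℂ) (j : Particle m) : rbr ζ j ∈ xFreeFun m τ ξ :=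
  br_mem_xFreeFun (cst_mem_xFreeFun ζ) (sig_mem_xFreeFun j)

theorem ringInverse_mem_xFreeFun {f : EvenFun m τ ξ} (hf : f ∈ xFreeFun m τ ξ) :
    Ring.inverse f ∈ xFreeFun m τ ξ :=
  ringInverse_mem_constants hf

/-! ### Derivations of the integrands -/

theorem isLeibniz_rTensor_derivation (D : Derivation ℂ (EvenFun m τ ξ) (EvenFun m τ ξ)) :
    IsLeibniz (D.toLinearMap.rTensor (Grass m)) :=
  IsLeibniz.rTensor fun x y => by simp [mul_comm, add_comm]

/-- The derivative with respect to a component of `σᵢ`, as a derivation of the even integrands. -/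
def sigDer (i : Fin m) (A : Fin 2) : Derivation ℂ (Even m τ ξ) (Even m τ ξ) :=
  (isLeibniz_rTensor_derivation (evenDer m τ ξ (EvenVar.sig i A))).centerDerivation

theorem sigDer_ev (i : Fin m) (A : Fin 2) (f : EvenFun m τ ξ) :
    sigDer i A (ev f) = ev (evenDer m τ ξ (EvenVar.sig i A) f) := rfl

theorem sigDer_oddProd (i : Fin m) (A : Fin 2) (u v : OddVar m) :
    sigDer i A (oddProd u v : Even m τ ξ) = 0 := Subtype.ext <| by
  change (evenDer m τ ξ _ 1) ⊗ₜ[ℂ] (odd m u * odd m v) = 0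
  rw [Derivation.map_one_eq_zero, TensorProduct.zero_tmul]

theorem odd_mul_odd_swap (u v : OddVar m) : odd m u * odd m v = -(odd m v * odd m u) :=
  eq_neg_of_add_eq_zero_left (ExteriorAlgebra.ι_add_mul_swap _ _)

theorem oddProd_swap (u v : OddVar m) : (oddProd u v : Even m τ ξ) = -oddProd v u :=
  Subtype.ext <| by
    change (1 : EvenFun m τ ξ) ⊗ₜ[ℂ] (odd m u * odd m v) = -(1 ⊗ₜ[ℂ] (odd m v * odd m u))
    rw [odd_mul_odd_swap, TensorProduct.tmul_neg]

/-- The even part of the vector field `[Wᵢ, ∂/∂X_A]`. -/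
def evenTwist (s : ℂ) (i : Particle m) (A : Fin 2) :
    Derivation ℂ (EvenFun m τ ξ) (EvenFun m τ ξ) :=
  ∑ α, ∑ β, infUpper (s ^ 2) α β • (evar (EvenVar.W i α) : EvenFun m τ ξ) •
    evenDer m τ ξ (EvenVar.X β A)

theorem evenTwist_apply (s : ℂ) (i : Particle m) (A : Fin 2) (f : EvenFun m τ ξ) :
    evenTwist s i A f = ∑ α, ∑ β, infUpper (s ^ 2) α β •
      (evar (EvenVar.W i α) * evenDer m τ ξ (EvenVar.X β A) f) := by
  rw [evenTwist, ← Derivation.coeFnAddMonoidHom_apply]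
  simp only [map_sum, Finset.sum_apply]
  rfl

theorem evenTwist_evar_X (s : ℂ) (i : Particle m) (A B : Fin 2) (β : Fin 4) :
    evenTwist s i A (evar (EvenVar.X β B) : EvenFun m τ ξ) =
      if B = A then ∑ α, infUpper (s ^ 2) α β • evar (EvenVar.W i α) else 0 := by
  classical
  simp only [evenTwist_apply, evenDer_evar, EvenVar.X.injEq]
  split_ifs with h <;> simp [h]

theorem evenTwist_eq_zero (s : ℂ) (i : Particle m) (A : Fin 2) {f : EvenFun m τ ξ}
    (hf : f ∈ xFreeFun m τ ξ) : evenTwist s i A f = 0 := by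
  simp [evenTwist_apply, fun β => hf (β, A)]

/-- The odd part of the vector field `[Wᵢ, ∂/∂X_A]`, up to the factor `s`. -/
def oddTwist (i : Particle m) (A : Fin 2) : Grass m →ₗ[ℂ] Grass m :=
  ∑ a, LinearMap.mulLeft ℂ (odd m (OddVar.W i a)) ∘ₗ
    CliffordAlgebra.contractLeft (Q := (0 : QuadraticForm ℂ (OddVar m →₀ ℂ)))
      (Finsupp.lapply (OddVar.X a A))

theorem isLeibniz_oddTwist (i : Particle m) (A : Fin 2) : IsLeibniz (oddTwist i A) :=
  IsLeibniz.sum fun _ _ => isLeibniz_mulLeft_comp_contractLeft _ _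

theorem contractLeft_odd [DecidableEq (OddVar m)] (u v : OddVar m) :
    CliffordAlgebra.contractLeft (Q := (0 : QuadraticForm ℂ (OddVar m →₀ ℂ)))
      (Finsupp.lapply u) (odd m v) = if v = u then 1 else 0 := by
  refine (CliffordAlgebra.contractLeft_ι _ _ _).trans ?_
  rw [Finsupp.lapply_apply, Finsupp.single_apply]
  split_ifs <;> simp

theorem oddTwist_odd_X (i : Particle m) (A B : Fin 2) (b : Fin 4) :
    oddTwist i A (odd m (OddVar.X b B)) = if B = A then odd m (OddVar.W i b) else 0 := by
  classical
  simp only [oddTwist, LinearMap.sum_apply, LinearMap.comp_apply, contractLeft_odd,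
    OddVar.X.injEq, LinearMap.mulLeft_apply]
  split_ifs with h <;> simp [h]

theorem oddTwist_odd_W (i j : Particle m) (A : Fin 2) (b : Fin 4) :
    oddTwist i A (odd m (OddVar.W j b)) = 0 := by
  classical
  simp [oddTwist, contractLeft_odd]

/-- The vector field `[Wᵢ, ∂/∂X_A]` on all integrands. -/
def twist (s : ℂ) (i : Particle m) (A : Fin 2) : Integrand m τ ξ →ₗ[ℂ] Integrand m τ ξ :=
  (evenTwist s i A).toLinearMap.rTensor (Grass m) + s • (oddTwist i A).lTensor (EvenFun m τ ξ)

theorem isLeibniz_twist (s : ℂ) (i : Particle m) (A : Fin 2) :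
    IsLeibniz (twist s i A : Integrand m τ ξ →ₗ[ℂ] Integrand m τ ξ) :=
  (isLeibniz_rTensor_derivation _).add ((isLeibniz_oddTwist i A).lTensor.smul s)

/-- The vector field `[Wᵢ, ∂/∂X_A]` as a derivation of the even integrands. -/
def twistDer (s : ℂ) (i : Particle m) (A : Fin 2) : Derivation ℂ (Even m τ ξ) (Even m τ ξ) :=
  (isLeibniz_twist s i A).centerDerivation

theorem coe_twistDer (s : ℂ) (i : Particle m) (A : Fin 2) (z : Even m τ ξ) :
    (twistDer s i A z : Integrand m τ ξ) = twist s i A z := rfl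

theorem twist_tmul (s : ℂ) (i : Particle m) (A : Fin 2) (f : EvenFun m τ ξ) (g : Grass m) :
    twist s i A (f ⊗ₜ g) = evenTwist s i A f ⊗ₜ[ℂ] g + s • (f ⊗ₜ[ℂ] oddTwist i A g) := rfl

theorem twistDer_ev (s : ℂ) (i : Particle m) (A : Fin 2) (f : EvenFun m τ ξ) :
    twistDer s i A (ev f) = ev (evenTwist s i A f) := Subtype.ext <| by
  have h1 : oddTwist i A (1 : Grass m) = 0 := by simp [oddTwist]
  rw [coe_twistDer, ev, twist_tmul, h1, TensorProduct.tmul_zero, smul_zero, add_zero]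
  rfl

theorem coe_twistDer_oddProd (s : ℂ) (i : Particle m) (A : Fin 2) (u v : OddVar m) :
    ((twistDer s i A (oddProd u v) : Even m τ ξ) : Integrand m τ ξ) =
      s • 1 ⊗ₜ[ℂ] (oddTwist i A (odd m u) * odd m v + odd m u * oddTwist i A (odd m v)) := by
  rw [coe_twistDer, oddProd, twist_tmul, Derivation.map_one_eq_zero, TensorProduct.zero_tmul,
    zero_add, isLeibniz_oddTwist]

theorem twistDer_oddProd_W_X (s : ℂ) (i j : Particle m) (A B : Fin 2) (b : Fin 4) :
    (twistDer s i A (oddProd (OddVar.W j b) (OddVar.X b B)) : Even m τ ξ) =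
      if B = A then s • oddProd (OddVar.W j b) (OddVar.W i b) else 0 := by
  refine Subtype.ext ((coe_twistDer_oddProd ..).trans ?_)
  rw [oddTwist_odd_W, oddTwist_odd_X, zero_mul, zero_add]
  split_ifs
  · rfl
  · simp

theorem twistDer_oddProd_X_X (s : ℂ) (i : Particle m) (A : Fin 2) (b : Fin 4) :
    (twistDer s i A (oddProd (OddVar.X b 0) (OddVar.X b 1)) : Even m τ ξ) =
      if A = 0 then s • oddProd (OddVar.W i b) (OddVar.X b 1)
      else s • oddProd (OddVar.X b 0) (OddVar.W i b) := by
  refine Subtype.ext ((coe_twistDer_oddProd ..).trans ?_)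
  rw [oddTwist_odd_X, oddTwist_odd_X]
  fin_cases A <;> simp [oddProd]

theorem twistDer_oddProd_W_W (s : ℂ) (i j k : Particle m) (A : Fin 2) (a b : Fin 4) :
    (twistDer s i A (oddProd (OddVar.W j a) (OddVar.W k b)) : Even m τ ξ) = 0 := Subtype.ext <| by
  rw [coe_twistDer_oddProd, oddTwist_odd_W, oddTwist_odd_W, mul_zero, zero_mul, add_zero,
    TensorProduct.tmul_zero, smul_zero]
  rfl

/-- The even integrands annihilated by all the vector fields `[Wᵢ, ∂/∂X_A]`, among them those
that do not depend on `X`. -/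
def xFree (m : ℕ) (τ : Fin 2 → Fin 2 → ℂ) (ξ : Fin 2 → ℂ) : Subalgebra ℂ (Even m τ ξ) :=
  constants fun p : ℂ × Particle m × Fin 2 => twistDer p.1 p.2.1 p.2.2

theorem ev_mem_xFree {f : EvenFun m τ ξ} (hf : f ∈ xFreeFun m τ ξ) : ev f ∈ xFree m τ ξ :=
  fun _ => by rw [twistDer_ev, evenTwist_eq_zero _ _ _ hf, ev_zero]

theorem oddProd_W_mem_xFree (i j : Particle m) (a b : Fin 4) :
    oddProd (OddVar.W i a) (OddVar.W j b) ∈ xFree m τ ξ :=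
  fun _ => twistDer_oddProd_W_W _ _ _ _ _ _ _

theorem wbr_eq (s : ℂ) (i j : Particle m) : (wbr s i j : Even m τ ξ) =
    (∑ α : Fin 4, ∑ β : Fin 4, infUpper (s ^ 2) α β •
      ev (evar (EvenVar.W i α) * evar (EvenVar.W j β))) -
    s • ∑ a : Fin 4, oddProd (OddVar.W i a) (OddVar.W j a) := rfl

theorem xsq_eq (s : ℂ) : (xsq s : Even m τ ξ) =
    (∑ α : Fin 4, ∑ β : Fin 4, infLower (s ^ 2) α β •
      ev (evar (EvenVar.X α 0) * evar (EvenVar.X β 1))) +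
    s • ∑ a : Fin 4, oddProd (OddVar.X a 0) (OddVar.X a 1) := rfl

/-- `Wᵢ · X_A`. -/
def wDotX (i : Particle m) (A : Fin 2) : Even m τ ξ :=
  (∑ α : Fin 4, ev (evar (EvenVar.W i α) * evar (EvenVar.X α A))) +
    ∑ a : Fin 4, oddProd (OddVar.W i a) (OddVar.X a A)

theorem expo_eq : expo m τ ξ =
    Complex.I • ∑ i : Particle m, ∑ A : Fin 2, ev (sig i A) * wDotX i A := rfl

theorem wbr_mem_xFree (s : ℂ) (i j : Particle m) : wbr s i j ∈ xFree m τ ξ := by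
  rw [wbr_eq]
  exact sub_mem (sum_mem fun _ _ => sum_mem fun _ _ => Subalgebra.smul_mem _
      (ev_mem_xFree (mul_mem (evar_W_mem_xFreeFun _ _) (evar_W_mem_xFreeFun _ _))) _)
    (Subalgebra.smul_mem _ (sum_mem fun _ _ => oddProd_W_mem_xFree _ _ _ _) _)

theorem twistDer_wDotX (s : ℂ) (i j : Particle m) (A B : Fin 2) :
    (twistDer s i A (wDotX j B) : Even m τ ξ) = if B = A then wbr s i j else 0 := by
  simp only [wDotX, map_add, map_sum, twistDer_ev, twistDer_oddProd_W_X, Derivation.leibniz,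
    evenTwist_evar_X, evenTwist_eq_zero _ _ _ (evar_W_mem_xFreeFun _ _), smul_zero, add_zero]
  split_ifs
  · simp only [wbr_eq, oddProd_swap (OddVar.W j _) (OddVar.W i _)]
    simp only [infUpper, Matrix.of_apply, Matrix.cons_val', Matrix.cons_val_fin_one,
      Fin.sum_univ_four, Fin.isValue, Matrix.cons_val_zero, Matrix.cons_val_one, Matrix.cons_val,
      smul_eq_mul, ev_mul, ev_add, ev_smul, zero_smul, zero_add, add_zero, Algebra.mul_smul_comm,
      neg_smul, mul_neg, one_smul, smul_neg, Finset.sum_neg_distrib, neg_add_rev, smul_add]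
    simp only [Algebra.smul_def, map_pow]
    ring
  · simp [ev_zero]

theorem twistDer_xsq (s : ℂ) (i : Particle m) (A : Fin 2) :
    (twistDer s i A (xsq s) : Even m τ ξ) =
      if A = 0 then s ^ 2 • wDotX i 1 else -(s ^ 2 • wDotX i 0) := by
  simp only [xsq_eq, wDotX, map_add, map_sum, Derivation.map_smul, twistDer_ev,
    twistDer_oddProd_X_X, Derivation.leibniz, evenTwist_evar_X,
    oddProd_swap (OddVar.X _ 0) (OddVar.W i _)]
  fin_cases A <;>
  · simp only [infLower, infUpper, Matrix.of_apply, Matrix.cons_val', Matrix.cons_val_fin_one,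
      Fin.isValue, Fin.zero_eta, Fin.mk_one, one_ne_zero, zero_ne_one, ↓reduceIte, smul_eq_mul,
      mul_zero, Fin.sum_univ_four, Matrix.cons_val_zero, Matrix.cons_val_one, Matrix.cons_val,
      zero_add, add_zero, ev_mul, ev_smul, ev_neg, zero_smul, one_smul, neg_smul,
      Algebra.mul_smul_comm, mul_neg, smul_neg, neg_neg, neg_zero, neg_add_rev, smul_add,
      Finset.sum_neg_distrib]
    simp only [Algebra.smul_def, map_pow]
    ring

/-! ### Integration by parts -/

theorem sigDer_xsq (s : ℂ) (i : Fin m) (A : Fin 2) : sigDer i A (xsq s : Even m τ ξ) = 0 := by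
  simp [xsq_eq, map_sum, sigDer_ev, sigDer_oddProd, evenDer_evar_of_ne, ev_zero]

theorem sigDer_wbr (s : ℂ) (i : Fin m) (A : Fin 2) (j k : Particle m) :
    sigDer i A (wbr s j k : Even m τ ξ) = 0 := by
  simp [wbr_eq, map_sum, sigDer_ev, sigDer_oddProd, evenDer_evar_of_ne, ev_zero]

theorem sigDer_wDotX (i : Fin m) (A : Fin 2) (j : Particle m) (B : Fin 2) :
    sigDer i A (wDotX j B : Even m τ ξ) = 0 := by
  simp [wDotX, map_sum, sigDer_ev, sigDer_oddProd, evenDer_evar_of_ne, ev_zero]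

theorem sigDer_expo (i : Fin m) (A : Fin 2) :
    sigDer i A (expo m τ ξ) = Complex.I • wDotX (Sum.inr i) A := by
  rw [expo_eq, Derivation.map_smul, map_sum]
  congr 1
  simp only [map_sum, Derivation.leibniz, sigDer_wDotX, sigDer_ev, smul_zero, zero_add,
    Fintype.sum_sum_type, evenDer_sig_inl, evenDer_sig_sig, ev_zero, Finset.sum_const_zero]
  rw [Finset.sum_eq_single i
      (fun j _ h => by
        simp only [h, false_and, if_false, ev_zero, smul_zero, Finset.sum_const_zero])
      (fun h => absurd (Finset.mem_univ i) h),
    Finset.sum_eq_single A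
      (fun B _ h => by simp only [h, and_false, if_false, ev_zero, smul_zero])
      (fun h => absurd (Finset.mem_univ A) h)]
  simp only [and_self, if_true, ev_one, smul_eq_mul, mul_one]

/-- The component `[Wᵢ, P^A]` of the momentum, where `P = ∑ⱼ Wⱼ σⱼ`. -/
def momentum (s : ℂ) (i : Particle m) (A : Fin 2) : Even m τ ξ :=
  ∑ j : Particle m, wbr s i j * ev (sig j A)

theorem twistDer_expo (s : ℂ) (i : Particle m) (A : Fin 2) :
    twistDer s i A (expo m τ ξ) = Complex.I • momentum s i A := by
  rw [expo_eq, Derivation.map_smul, map_sum]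
  congr 1
  refine Finset.sum_congr rfl fun j _ => ?_
  simp only [map_sum, Derivation.leibniz, twistDer_wDotX, twistDer_ev, ev_zero,
    evenTwist_eq_zero _ _ _ (sig_mem_xFreeFun _ _), add_zero, smul_eq_mul, mul_ite, mul_zero]
  rw [Fintype.sum_ite_eq', mul_comm]

theorem totalDer_apply (v : IntVar m) (F : Integrand m τ ξ) :
    totalDer m τ ξ v F = partialDer m τ ξ v F + partialDer m τ ξ v (expo m τ ξ) * F := rfl

theorem totalDer_mem (v : IntVar m) (F : Integrand m τ ξ) :
    totalDer m τ ξ v F ∈ totalDerivatives m τ ξ :=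
  Submodule.mem_iSup_of_mem v ⟨F, rfl⟩

theorem mul_totalDer_even_mem {f : EvenFun m τ ξ} (hf : f ∈ xFreeFun m τ ξ) (α : Fin 4)
    (A : Fin 2) (F : Integrand m τ ξ) :
    (ev f : Integrand m τ ξ) * totalDer m τ ξ (IntVar.even α A) F ∈ totalDerivatives m τ ξ := by
  have hLeibniz : IsLeibniz (partialDer m τ ξ (IntVar.even α A)) := isLeibniz_rTensor_derivation _
  have hzero : partialDer m τ ξ (IntVar.even α A) (ev f : Integrand m τ ξ) = 0 := by
    change (evenDer m τ ξ (EvenVar.X α A) f) ⊗ₜ[ℂ] (1 : Grass m) = 0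
    rw [hf (α, A), TensorProduct.zero_tmul]
  have hcomm := Subalgebra.mem_center_iff.1 (ev f).2
  have h : (ev f : Integrand m τ ξ) * totalDer m τ ξ (IntVar.even α A) F =
      totalDer m τ ξ (IntVar.even α A) ((ev f : Integrand m τ ξ) * F) := by
    rw [totalDer_apply, totalDer_apply, hLeibniz, hzero, zero_mul, zero_add, mul_add,
      ← mul_assoc, ← mul_assoc,
      hcomm (partialDer m τ ξ _ (expo m τ ξ : Even m τ ξ))]
  rw [h]
  exact totalDer_mem _ _

theorem partialDer_odd_W_mul (i : Particle m) (a b : Fin 4) (A : Fin 2) (F : Integrand m τ ξ) :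
    partialDer m τ ξ (IntVar.odd b A) ((1 ⊗ₜ odd m (OddVar.W i a)) * F) =
      -((1 ⊗ₜ odd m (OddVar.W i a)) * partialDer m τ ξ (IntVar.odd b A) F) := by
  classical
  induction F using TensorProduct.induction_on with
  | zero => simp only [mul_zero, map_zero, neg_zero]
  | tmul f g =>
    have hW : Finsupp.lapply (R := ℂ) (OddVar.X b A)
        (Finsupp.single (OddVar.W i a) (1 : ℂ)) = 0 := by simp
    have h : CliffordAlgebra.contractLeft (Q := (0 : QuadraticForm ℂ (OddVar m →₀ ℂ)))
        (Finsupp.lapply (OddVar.X b A)) (odd m (OddVar.W i a) * g) = _ :=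
      CliffordAlgebra.contractLeft_ι_mul _ _ _
    rw [hW, zero_smul, zero_sub] at h
    rw [Algebra.TensorProduct.tmul_mul_tmul]
    change _ ⊗ₜ[ℂ] CliffordAlgebra.contractLeft _ _ = -(_ * (_ ⊗ₜ[ℂ] _))
    rw [h, TensorProduct.tmul_neg, Algebra.TensorProduct.tmul_mul_tmul]
    rfl
  | add x y hx hy => rw [mul_add, map_add, map_add, hx, hy, mul_add, neg_add]

theorem partialDer_mul_odd_W (i : Particle m) (a b : Fin 4) (A : Fin 2) (F : Integrand m τ ξ) :
    partialDer m τ ξ (IntVar.odd b A) (F * (1 ⊗ₜ odd m (OddVar.W i a))) =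
      partialDer m τ ξ (IntVar.odd b A) F * (1 ⊗ₜ odd m (OddVar.W i a)) := by
  classical
  induction F using TensorProduct.induction_on with
  | zero => simp only [zero_mul, map_zero]
  | tmul f g =>
    rw [Algebra.TensorProduct.tmul_mul_tmul]
    change _ ⊗ₜ[ℂ] CliffordAlgebra.contractLeft _ (g * odd m _) = (_ ⊗ₜ[ℂ] _) * _
    rw [contractLeft_mul_of_contractLeft_eq_zero (by simp [contractLeft_odd]),
      Algebra.TensorProduct.tmul_mul_tmul]
    exact congrArg (· ⊗ₜ[ℂ] _) rfl
  | add x y hx hy => rw [add_mul, map_add, map_add, hx, hy, add_mul]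

theorem odd_W_mul_totalDer_odd_mem (i : Particle m) (a b : Fin 4) (A : Fin 2)
    (F : Integrand m τ ξ) :
    (1 ⊗ₜ odd m (OddVar.W i a) : Integrand m τ ξ) * totalDer m τ ξ (IntVar.odd b A) F ∈
      totalDerivatives m τ ξ := by
  set θ : Integrand m τ ξ := 1 ⊗ₜ odd m (OddVar.W i a) with hθ
  -- `θ ∂E = -∂(θ E) = -∂(E θ) = -∂E θ`, since the exponent `E` is even
  have hE : θ * partialDer m τ ξ (IntVar.odd b A) (expo m τ ξ).1 +
      partialDer m τ ξ (IntVar.odd b A) (expo m τ ξ).1 * θ = 0 := by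
    rw [hθ, ← partialDer_mul_odd_W, ← Subalgebra.mem_center_iff.1 (expo m τ ξ).2,
      partialDer_odd_W_mul, add_neg_cancel]
  have h : θ * totalDer m τ ξ (IntVar.odd b A) F =
      -totalDer m τ ξ (IntVar.odd b A) (θ * F) := by
    rw [eq_neg_iff_add_eq_zero, totalDer_apply, totalDer_apply, partialDer_odd_W_mul, mul_add,
      ← mul_assoc, ← mul_assoc, add_add_add_comm, add_neg_cancel, zero_add, ← add_mul, hE,
      zero_mul]
  rw [h]
  exact neg_mem (totalDer_mem _ _)

theorem twist_apply (s : ℂ) (i : Particle m) (A : Fin 2) (F : Integrand m τ ξ) :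
    twist s i A F =
      (∑ α, ∑ β, infUpper (s ^ 2) α β •
        (((ev (evar (EvenVar.W i α)) : Even m τ ξ) : Integrand m τ ξ) *
          partialDer m τ ξ (IntVar.even β A) F)) +
      s • ∑ a, (1 ⊗ₜ odd m (OddVar.W i a)) * partialDer m τ ξ (IntVar.odd a A) F := by
  induction F using TensorProduct.induction_on with
  | zero => simp
  | tmul f g =>
    rw [twist_tmul, evenTwist_apply]
    simp [oddTwist, TensorProduct.sum_tmul, TensorProduct.tmul_sum, partialDer, ev,
      TensorProduct.smul_tmul']
  | add x y hx hy =>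
    simp only [map_add, hx, hy, mul_add, smul_add, Finset.sum_add_distrib]
    abel

theorem twist_add_mem (s : ℂ) (i : Particle m) (A : Fin 2) (F : Integrand m τ ξ) :
    twist s i A F + twist s i A (expo m τ ξ : Even m τ ξ) * F ∈ totalDerivatives m τ ξ := by
  have h : twist s i A F + twist s i A (expo m τ ξ : Even m τ ξ) * F =
      (∑ α, ∑ β, infUpper (s ^ 2) α β •
        (((ev (evar (EvenVar.W i α)) : Even m τ ξ) : Integrand m τ ξ) *
          totalDer m τ ξ (IntVar.even β A) F)) +
      s • ∑ a, (1 ⊗ₜ odd m (OddVar.W i a)) * totalDer m τ ξ (IntVar.odd a A) F := by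
    simp only [twist_apply, totalDer_apply, mul_add, add_mul, Finset.sum_add_distrib, smul_add,
      Finset.sum_mul, smul_mul_assoc, mul_assoc]
    abel
  rw [h]
  exact add_mem (sum_mem fun α _ => sum_mem fun β _ => Submodule.smul_mem _ _
      (mul_totalDer_even_mem (evar_W_mem_xFreeFun i α) β A F))
    (Submodule.smul_mem _ _ (sum_mem fun a _ => odd_W_mul_totalDer_odd_mem i a a A F))

/-- The even integrands whose integral vanishes: those that are sums of total derivatives. -/
def exactIntegrands (m : ℕ) (τ : Fin 2 → Fin 2 → ℂ) (ξ : Fin 2 → ℂ) :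
    Submodule ℂ (Even m τ ξ) :=
  (totalDerivatives m τ ξ).comap (Subalgebra.center ℂ (Integrand m τ ξ)).val.toLinearMap

theorem twistDer_add_momentum_mul_mem (s : ℂ) (i : Particle m) (A : Fin 2) (z : Even m τ ξ) :
    twistDer s i A z + Complex.I • (momentum s i A * z) ∈ exactIntegrands m τ ξ := by
  rw [← smul_mul_assoc, ← twistDer_expo]
  exact twist_add_mem s i A z.1

theorem sigDer_add_wDotX_mul_mem (i : Fin m) (A : Fin 2) (z : Even m τ ξ) :
    sigDer i A z + Complex.I • (wDotX (Sum.inr i) A * z) ∈ exactIntegrands m τ ξ := by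
  rw [← smul_mul_assoc, ← sigDer_expo]
  exact totalDer_mem (IntVar.sig i A) z.1

/-- The contraction `[Wᵢ, P(η)]` of the momentum with a spinor `η`. -/
def momentumAt (s : ℂ) (i : Particle m) (η : Fin 2 → EvenFun m τ ξ) : Even m τ ξ :=
  ∑ j : Particle m, wbr s i j * ev (br η (sig j))

theorem momentumAt_eq (s : ℂ) (i : Particle m) (η : Fin 2 → EvenFun m τ ξ) :
    momentumAt s i η = ev (η 0) * momentum s i 1 - ev (η 1) * momentum s i 0 := by
  simp only [momentumAt, momentum, br, ev_sub, ev_mul, Finset.mul_sum, mul_sub,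
    Finset.sum_sub_distrib]
  congr 1 <;> exact Finset.sum_congr rfl fun j _ => by ring

theorem xsq_sq_mul_momentumAt_mem (s : ℂ) (i : Fin m) {η : Fin 2 → EvenFun m τ ξ}
    (hη : ∀ A, η A ∈ xFreeFun m τ ξ) {f : Even m τ ξ} (hf : f ∈ xFree m τ ξ) :
    xsq s ^ 2 * (momentumAt s (Sum.inr i) η * f) -
      (2 * s ^ 2) • (xsq s * ∑ A, sigDer i A (ev (η A) * f)) ∈ exactIntegrands m τ ξ := by
  have hX (A B) : twistDer s (Sum.inr i) A (xsq s ^ 2 * (ev (η B) * f)) =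
      2 * xsq s * twistDer s (Sum.inr i) A (xsq s) * (ev (η B) * f) := by
    have hfree := mul_mem (ev_mem_xFree (hη B)) hf (s, Sum.inr i, A)
    rw [Derivation.leibniz, hfree, Derivation.leibniz_pow]
    simp only [smul_eq_mul, nsmul_eq_mul]
    ring
  have h1 := twistDer_add_momentum_mul_mem s (Sum.inr i) 1 (xsq s ^ 2 * (ev (η 0) * f))
  have h0 := twistDer_add_momentum_mul_mem s (Sum.inr i) 0 (xsq s ^ 2 * (ev (η 1) * f))
  have hσ (A : Fin 2) := sigDer_add_wDotX_mul_mem i A (xsq s * (ev (η A) * f))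
  rw [hX, twistDer_xsq] at h1 h0
  simp only [Derivation.leibniz (sigDer i _) (xsq s), sigDer_xsq, smul_zero, add_zero] at hσ
  convert sub_mem (Submodule.smul_mem _ (-Complex.I) (sub_mem h1 h0))
    (Submodule.smul_mem _ (2 * s ^ 2) (add_mem (hσ 0) (hσ 1))) using 1
  have hI : algebraMap ℂ (Even m τ ξ) Complex.I ^ 2 = -1 := by
    rw [← map_pow, Complex.I_sq, map_neg, map_one]
  rw [momentumAt_eq, Fin.sum_univ_two, if_neg one_ne_zero, if_pos rfl]
  simp only [Algebra.smul_def, map_mul, map_pow, map_neg, map_ofNat]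
  linear_combination (xsq s ^ 2 * f * (ev (η 0) * momentum s (Sum.inr i) 1 -
    ev (η 1) * momentum s (Sum.inr i) 0)) * hI

theorem xsq_zero_mul_momentum_mem (i : Particle m) (A : Fin 2) {f : Even m τ ξ}
    (hf : f ∈ xFree m τ ξ) : xsq 0 * (momentum 0 i A * f) ∈ exactIntegrands m τ ξ := by
  have h := Submodule.smul_mem _ (-Complex.I) (twistDer_add_momentum_mul_mem 0 i A (xsq 0 * f))
  have hX : twistDer 0 i A (xsq 0 * f) = 0 := by
    rw [Derivation.leibniz, hf (0, i, A), twistDer_xsq]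
    simp only [zero_pow two_ne_zero, zero_smul, neg_zero, ite_self, smul_zero, add_zero]
  rwa [hX, zero_add, smul_smul, neg_mul, Complex.I_mul_I, neg_neg, one_smul,
    mul_left_comm] at h

/-! ### Invertible spinor products -/

theorem isUnit_of_dvd_denom {p : MvPolynomial (EvenVar m) ℂ} (h : p ∣ denom m τ ξ) :
    IsUnit (algebraMap _ (EvenFun m τ ξ) p) :=
  isUnit_of_dvd_unit (map_dvd _ h)
    (IsLocalization.map_units (EvenFun m τ ξ)
      (⟨denom m τ ξ, Submonoid.mem_powers _⟩ : Submonoid.powers (denom m τ ξ)))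

theorem isUnit_br_of_dvd_denom {u v : Fin 2 → MvPolynomial (EvenVar m) ℂ}
    (h : br u v ∣ denom m τ ξ) :
    IsUnit (br (fun A => algebraMap _ (EvenFun m τ ξ) (u A)) fun A => algebraMap _ _ (v A)) := by
  have hu := isUnit_of_dvd_denom h
  rwa [br, map_sub, map_mul, map_mul] at hu

theorem sbr_swap (i j : Particle m) : (sbr i j : EvenFun m τ ξ) = -sbr j i := br_swap _ _

theorem factor_dvd_denom (i : Fin m) :
    br (sigPoly m τ (Sum.inl 0)) (sigPoly m τ (Sum.inr i)) *
      br (sigPoly m τ (Sum.inl 1)) (sigPoly m τ (Sum.inr i)) *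
      br (fun A => MvPolynomial.C (ξ A)) (sigPoly m τ (Sum.inr i)) ∣ denom m τ ξ :=
  (Finset.dvd_prod_of_mem (fun i : Fin m =>
    br (sigPoly m τ (Sum.inl 0)) (sigPoly m τ (Sum.inr i)) *
      br (sigPoly m τ (Sum.inl 1)) (sigPoly m τ (Sum.inr i)) *
      br (fun A => MvPolynomial.C (ξ A)) (sigPoly m τ (Sum.inr i))) (Finset.mem_univ i)).trans
    (dvd_mul_right _ _)

theorem isUnit_sbr_inl (p : Fin 2) (i : Fin m) :
    IsUnit (sbr (Sum.inl p) (Sum.inr i) : EvenFun m τ ξ) := by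
  refine isUnit_br_of_dvd_denom (Dvd.dvd.trans ?_ (factor_dvd_denom i))
  fin_cases p
  · exact (dvd_mul_right _ _).mul_right _
  · exact (dvd_mul_left _ _).mul_right _

theorem isUnit_rbr (i : Fin m) : IsUnit (rbr ξ (Sum.inr i) : EvenFun m τ ξ) :=
  isUnit_br_of_dvd_denom ((dvd_mul_left _ _).trans (factor_dvd_denom i))

theorem isUnit_sbr_inr {i j : Fin m} (h : i ≠ j) :
    IsUnit (sbr (Sum.inr i) (Sum.inr j) : EvenFun m τ ξ) := by
  wlog hij : i < j generalizing i j
  · rw [sbr_swap]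
    exact (this h.symm (lt_of_le_of_ne (not_lt.1 hij) h.symm)).neg
  exact isUnit_br_of_dvd_denom ((Finset.dvd_prod_of_mem (fun p : Fin m × Fin m =>
    br (sigPoly m τ (Sum.inr p.1)) (sigPoly m τ (Sum.inr p.2)))
    (Finset.mem_filter.2 ⟨Finset.mem_univ (i, j), hij⟩)).trans (dvd_mul_left _ _))

theorem isUnit_sbr {i : Fin m} {k : Particle m} (h : k ≠ Sum.inr i) :
    IsUnit (sbr (Sum.inr i) k : EvenFun m τ ξ) := by
  rcases k with p | j
  · rw [sbr_swap]
    exact (isUnit_sbr_inl p i).neg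
  · exact isUnit_sbr_inr fun hij => h (by rw [hij])

theorem ringInverse_neg {R : Type*} [Ring R] (x : R) : Ring.inverse (-x) = -Ring.inverse x := by
  by_cases h : IsUnit x
  · exact h.neg.mul_left_cancel (by
      rw [Ring.mul_inverse_cancel _ h.neg, neg_mul_neg, Ring.mul_inverse_cancel _ h])
  · rw [Ring.inverse_non_unit _ h, Ring.inverse_non_unit _ (by rwa [IsUnit.neg_iff]), neg_zero]

/-! ### The Hodges matrix -/

theorem infUpper_swap (Λ : ℂ) (α β : Fin 4) : infUpper Λ β α = -infUpper Λ α β := by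
  fin_cases α <;> fin_cases β <;> simp [infUpper]

theorem wbr_swap (s : ℂ) (i j : Particle m) : (wbr s j i : Even m τ ξ) = -wbr s i j := by
  have hodd : ∑ a : Fin 4, (oddProd (OddVar.W j a) (OddVar.W i a) : Even m τ ξ) =
      -∑ a : Fin 4, oddProd (OddVar.W i a) (OddVar.W j a) := by
    rw [← Finset.sum_neg_distrib]
    exact Finset.sum_congr rfl fun a _ => oddProd_swap _ _
  have heven : ∑ α : Fin 4, ∑ β : Fin 4, infUpper (s ^ 2) α β •
      (ev (evar (EvenVar.W j α) * evar (EvenVar.W i β)) : Even m τ ξ) =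
      -∑ α : Fin 4, ∑ β : Fin 4, infUpper (s ^ 2) α β •
        ev (evar (EvenVar.W i α) * evar (EvenVar.W j β)) := by
    rw [Finset.sum_comm]
    simp only [← Finset.sum_neg_distrib]
    refine Finset.sum_congr rfl fun α _ => Finset.sum_congr rfl fun β _ => ?_
    rw [infUpper_swap _ α β, neg_smul, mul_comm]
  rw [wbr_eq, wbr_eq, hodd, heven, smul_neg]
  ring

theorem wbr_self (s : ℂ) (i : Particle m) : (wbr s i i : Even m τ ξ) = 0 := by
  linear_combination (norm := module) (2⁻¹ : ℂ) • wbr_swap s i i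

theorem hodgesOff_eq (s : ℂ) (i j : Particle m) :
    (hodgesOff s i j : Even m τ ξ) = -(wbr s i j * ev (Ring.inverse (sbr i j))) := rfl

theorem hodgesOff_swap (s : ℂ) (i j : Particle m) :
    (hodgesOff s j i : Even m τ ξ) = hodgesOff s i j := by
  rw [hodgesOff_eq, hodgesOff_eq, wbr_swap, sbr_swap, ringInverse_neg, ev_neg, neg_mul_neg]

theorem hodges_of_ne (s : ℂ) (ζ : Fin 2 → ℂ) {i j : Particle m} (h : i ≠ j) :
    (hodges s ζ i j : Even m τ ξ) = hodgesOff s i j :=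
  if_neg h

theorem hodges_self (s : ℂ) (ζ : Fin 2 → ℂ) (i : Particle m) :
    (hodges s ζ i i : Even m τ ξ) = -∑ k ∈ Finset.univ.erase i,
      hodgesOff s i k * ev (rbr ζ k ^ 2 * Ring.inverse (rbr ζ i) ^ 2) :=
  if_pos rfl

/-- The Hodges matrix without the rows and columns `1`, `2`. -/
def core (s : ℂ) (ζ : Fin 2 → ℂ) : Matrix (Fin m) (Fin m) (Even m τ ξ) :=
  (hodges s ζ).submatrix Sum.inr Sum.inr

theorem core_of_ne (s : ℂ) (ζ : Fin 2 → ℂ) {i j : Fin m} (h : i ≠ j) :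
    (core s ζ i j : Even m τ ξ) = hodgesOff s (Sum.inr i) (Sum.inr j) :=
  hodges_of_ne s ζ (Sum.inr_injective.ne h)

theorem core_self (s : ℂ) (ζ : Fin 2 → ℂ) (i : Fin m) :
    (core s ζ i i : Even m τ ξ) = -∑ k ∈ Finset.univ.erase (Sum.inr i),
      hodgesOff s (Sum.inr i) k *
        ev (rbr ζ k ^ 2 * Ring.inverse (rbr ζ (Sum.inr i)) ^ 2) :=
  hodges_self s ζ (Sum.inr i)

theorem core_isSymm (s : ℂ) (ζ : Fin 2 → ℂ) :
    (core s ζ : Matrix (Fin m) (Fin m) (Even m τ ξ)).IsSymm := by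
  ext i j
  rcases eq_or_ne i j with rfl | h
  · rfl
  · rw [Matrix.transpose_apply, core_of_ne s ζ h, core_of_ne s ζ h.symm, hodgesOff_swap]

theorem reduced_empty (s : ℂ) (ζ : Fin 2 → ℂ) :
    (reduced s ζ ∅ : Even m τ ξ) = (core s ζ).det :=
  Matrix.det_submatrix_equiv_self
    (Equiv.subtypeUnivEquiv (p := fun i : Fin m => i ∉ (∅ : Finset _)) Finset.notMem_empty)
    (core s ζ)

theorem reduced_singleton (s : ℂ) (ζ : Fin 2 → ℂ) (i : Fin m) :
    (reduced s ζ {i} : Even m τ ξ) = (core s ζ).adjugate i i :=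
  det_submatrix_notMem_singleton (core s ζ) i

theorem hodgesOff_mem_xFree (s : ℂ) (i j : Particle m) : hodgesOff s i j ∈ xFree m τ ξ :=
  neg_mem (mul_mem (wbr_mem_xFree s i j)
    (ev_mem_xFree (ringInverse_mem_xFreeFun (sbr_mem_xFreeFun i j))))

theorem core_mem_xFree (s : ℂ) (ζ : Fin 2 → ℂ) (i j : Fin m) : core s ζ i j ∈ xFree m τ ξ := by
  rcases eq_or_ne i j with rfl | h
  · rw [core_self]
    exact neg_mem (sum_mem fun k _ => mul_mem (hodgesOff_mem_xFree _ _ _)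
      (ev_mem_xFree (mul_mem (pow_mem (rbr_mem_xFreeFun ζ k) 2)
        (pow_mem (ringInverse_mem_xFreeFun (rbr_mem_xFreeFun ζ _)) 2))))
  · rw [core_of_ne s ζ h]
    exact hodgesOff_mem_xFree _ _ _

/-! ### The null vector of the Hodges matrix -/

/-- The spinor `ηᵢ` along which `σᵢ` is varied. -/
def eta (ζ : Fin 2 → ℂ) (i : Fin m) : Fin 2 → EvenFun m τ ξ :=
  etaSpinor (sig (Sum.inl 0)) (sig (Sum.inl 1)) (cst ζ) (sig (Sum.inr i))

theorem eta_mem_xFreeFun (ζ : Fin 2 → ℂ) (i : Fin m) (A : Fin 2) :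
    eta ζ i A ∈ xFreeFun m τ ξ := by
  have h (p : Fin 2) : br (sig (Sum.inl p : Particle m)) (cst ζ) ∈ xFreeFun m τ ξ :=
    br_mem_xFreeFun (sig_mem_xFreeFun _) (cst_mem_xFreeFun ζ)
  exact sub_mem (mul_mem (add_mem (mul_mem (h 0) (sbr_mem_xFreeFun _ _))
    (mul_mem (h 1) (sbr_mem_xFreeFun _ _))) (cst_mem_xFreeFun ζ A))
    (mul_mem (mul_mem (h 0) (h 1)) (sig_mem_xFreeFun _ A))

/-- The components `(1k)(2k)` of the vector that the Hodges matrix annihilates on the support of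
momentum conservation. -/
def nullVec (k : Particle m) : EvenFun m τ ξ := sbr (Sum.inl 0) k * sbr (Sum.inl 1) k

theorem nullVec_inl (p : Fin 2) : (nullVec (Sum.inl p : Particle m) : EvenFun m τ ξ) = 0 := by
  fin_cases p
  · exact mul_eq_zero_of_left (br_self _) _
  · exact mul_eq_zero_of_right _ (br_self _)

/-- The inverse of `nullVec`. -/
def nullInv (i : Fin m) : EvenFun m τ ξ :=
  Ring.inverse (sbr (Sum.inl 0) (Sum.inr i)) * Ring.inverse (sbr (Sum.inl 1) (Sum.inr i))

theorem nullVec_mul_nullInv (i : Fin m) :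
    (nullVec (Sum.inr i) * nullInv i : EvenFun m τ ξ) = 1 := by
  rw [nullVec, nullInv, mul_mul_mul_comm, Ring.mul_inverse_cancel _ (isUnit_sbr_inl 0 i),
    Ring.mul_inverse_cancel _ (isUnit_sbr_inl 1 i), one_mul]

theorem inverse_sbr_mul_nullVec_sub (ζ : Fin 2 → ℂ) {i : Fin m} {k : Particle m}
    (hζ : IsUnit (rbr ζ (Sum.inr i) : EvenFun m τ ξ)) (hk : k ≠ Sum.inr i) :
    Ring.inverse (sbr (Sum.inr i) k) *
        (rbr ζ k ^ 2 * Ring.inverse (rbr ζ (Sum.inr i)) ^ 2 * nullVec (Sum.inr i) - nullVec k) =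
      Ring.inverse (rbr ζ (Sum.inr i)) ^ 2 * (br (eta ζ i) (sig k) : EvenFun m τ ξ) := by
  have hinv := Ring.mul_inverse_cancel _ (isUnit_sbr (τ := τ) (ξ := ξ) hk)
  have hu := Ring.mul_inverse_cancel _ hζ
  have hid : (sbr (Sum.inr i) k * br (eta ζ i) (sig k) : EvenFun m τ ξ) =
      nullVec (Sum.inr i) * rbr ζ k ^ 2 - nullVec k * rbr ζ (Sum.inr i) ^ 2 :=
    br_mul_br_etaSpinor _ _ _ _ _
  set v := Ring.inverse (sbr (Sum.inr i) k : EvenFun m τ ξ)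
  set u := Ring.inverse (rbr ζ (Sum.inr i) : EvenFun m τ ξ)
  linear_combination (-v * u ^ 2) * hid + (u ^ 2 * br (eta ζ i) (sig k)) * hinv
    + v * nullVec k * (rbr ζ (Sum.inr i) * u + 1) * hu

open Matrix in
theorem core_mulVec_nullVec (s : ℂ) (ζ : Fin 2 → ℂ) (i : Fin m)
    (hζ : IsUnit (rbr ζ (Sum.inr i) : EvenFun m τ ξ)) :
    (core s ζ *ᵥ fun j => ev (nullVec (Sum.inr j) : EvenFun m τ ξ)) i =
      ev (Ring.inverse (rbr ζ (Sum.inr i)) ^ 2) * momentumAt s (Sum.inr i) (eta ζ i) := by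
  have hfull : (core s ζ *ᵥ fun j => ev (nullVec (Sum.inr j) : EvenFun m τ ξ)) i =
      ∑ k : Particle m, hodges s ζ (Sum.inr i) k * ev (nullVec k : EvenFun m τ ξ) := by
    simp only [Fintype.sum_sum_type, nullVec_inl, ev_zero, mul_zero, Finset.sum_const_zero,
      zero_add]
    rfl
  rw [hfull, momentumAt, ← Finset.add_sum_erase _ _ (Finset.mem_univ (Sum.inr i : Particle m)),
    ← Finset.add_sum_erase Finset.univ (fun j => wbr s (Sum.inr i) j * _)
      (Finset.mem_univ (Sum.inr i : Particle m)), wbr_self, zero_mul, zero_add,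
    hodges_self, neg_mul, Finset.sum_mul, Finset.mul_sum, ← Finset.sum_neg_distrib,
    ← Finset.sum_add_distrib]
  refine Finset.sum_congr rfl fun k hk => ?_
  have hk' : k ≠ Sum.inr i := Finset.ne_of_mem_erase hk
  have key := congrArg (fun x => wbr s (Sum.inr i) k * ev x) (inverse_sbr_mul_nullVec_sub ζ hζ hk')
  rw [hodges_of_ne s ζ hk'.symm, hodgesOff_eq]
  simp only [ev_mul, ev_sub] at key ⊢
  linear_combination key

/-! ### The divergence of the first minors -/

/-- The derivative of functions along the variation `σᵢ ↦ σᵢ + ε ηᵢ`. -/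
def etaDerFun (i : Fin m) : Derivation ℂ (EvenFun m τ ξ) (EvenFun m τ ξ) :=
  ∑ A, (eta ξ i A : EvenFun m τ ξ) • evenDer m τ ξ (EvenVar.sig i A)

/-- The derivative of even integrands along the variation `σᵢ ↦ σᵢ + ε ηᵢ`. -/
def etaDer (i : Fin m) : Derivation ℂ (Even m τ ξ) (Even m τ ξ) :=
  ∑ A, (ev (eta ξ i A) : Even m τ ξ) • sigDer i A

theorem etaDerFun_apply (i : Fin m) (f : EvenFun m τ ξ) :
    etaDerFun i f = eta ξ i 0 * evenDer m τ ξ (EvenVar.sig i 0) f +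
      eta ξ i 1 * evenDer m τ ξ (EvenVar.sig i 1) f := by
  simp only [etaDerFun, Fin.sum_univ_two, Derivation.add_apply, Derivation.smul_apply,
    smul_eq_mul]

theorem etaDer_apply (i : Fin m) (z : Even m τ ξ) :
    etaDer i z = ev (eta ξ i 0) * sigDer i 0 z + ev (eta ξ i 1) * sigDer i 1 z := by
  simp only [etaDer, Fin.sum_univ_two, Derivation.add_apply, Derivation.smul_apply, smul_eq_mul]

theorem etaDer_ev (i : Fin m) (f : EvenFun m τ ξ) : etaDer i (ev f) = ev (etaDerFun i f) := by
  rw [etaDer_apply, etaDerFun_apply, sigDer_ev, sigDer_ev, ev_add, ev_mul, ev_mul]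

theorem etaDer_wbr (i : Fin m) (s : ℂ) (j k : Particle m) :
    etaDer i (wbr s j k : Even m τ ξ) = 0 := by
  rw [etaDer_apply, sigDer_wbr, sigDer_wbr, mul_zero, mul_zero, add_zero]

theorem sum_evenDer_eta (i : Fin m) :
    ∑ A, evenDer m τ ξ (EvenVar.sig i A) (eta ξ i A) = 0 := by
  have hself (A B : Fin 2) : evenDer m τ ξ (EvenVar.sig i A) (sig (Sum.inr i) B) =
      if B = A then 1 else 0 := by simp [evenDer_sig_sig]
  simp only [Fin.sum_univ_two, eta, etaSpinor, etaCoeff, br, map_add, map_sub,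
    Derivation.leibniz, evenDer_cst, evenDer_sig_inl, hself, smul_eq_mul, if_true,
    one_ne_zero, zero_ne_one, if_false]
  ring

theorem sum_sigDer_eta (i : Fin m) (f : Even m τ ξ) :
    ∑ A, sigDer i A (ev (eta ξ i A) * f) = etaDer i f := by
  have h := congrArg (ev (m := m) (τ := τ) (ξ := ξ)) (sum_evenDer_eta i)
  rw [Fin.sum_univ_two, ev_add, ev_zero, ← sigDer_ev, ← sigDer_ev] at h
  rw [Fin.sum_univ_two, etaDer_apply, Derivation.leibniz, Derivation.leibniz]
  simp only [smul_eq_mul]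
  linear_combination f * h

theorem etaDerFun_cst (i : Fin m) (ζ : Fin 2 → ℂ) (A : Fin 2) :
    etaDerFun i (cst ζ A : EvenFun m τ ξ) = 0 :=
  Derivation.map_algebraMap _ _

theorem etaDerFun_sig_self (i : Fin m) (A : Fin 2) :
    etaDerFun i (sig (Sum.inr i) A : EvenFun m τ ξ) = eta ξ i A := by
  rw [etaDerFun_apply, evenDer_sig_sig, evenDer_sig_sig]
  fin_cases A <;> simp

theorem etaDerFun_sig_of_ne {i : Fin m} {k : Particle m} (h : k ≠ Sum.inr i) (A : Fin 2) :
    etaDerFun i (sig k A : EvenFun m τ ξ) = 0 := by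
  rcases k with p | j
  · rw [sig_inl, etaDerFun_cst]
  · have hj : j ≠ i := fun hj => h (by rw [hj])
    rw [etaDerFun_apply, evenDer_sig_sig, evenDer_sig_sig]
    simp [hj]

theorem etaDerFun_sbr_of_ne {i : Fin m} {j k : Particle m} (hj : j ≠ Sum.inr i)
    (hk : k ≠ Sum.inr i) : etaDerFun i (sbr j k : EvenFun m τ ξ) = 0 := by
  simp only [sbr, derivation_br, etaDerFun_sig_of_ne hj, etaDerFun_sig_of_ne hk,
    br_zero_left, br_zero_right, add_zero]

theorem etaDerFun_sbr_right {i : Fin m} {k : Particle m} (hk : k ≠ Sum.inr i) :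
    etaDerFun i (sbr k (Sum.inr i) : EvenFun m τ ξ) = br (sig k) (eta ξ i) := by
  simp only [sbr, derivation_br, etaDerFun_sig_of_ne hk, etaDerFun_sig_self,
    br_zero_left, zero_add]

theorem etaDerFun_sbr_left {i : Fin m} {k : Particle m} (hk : k ≠ Sum.inr i) :
    etaDerFun i (sbr (Sum.inr i) k : EvenFun m τ ξ) = br (eta ξ i) (sig k) := by
  simp only [sbr, derivation_br, etaDerFun_sig_of_ne hk, etaDerFun_sig_self,
    br_zero_right, add_zero]

theorem etaDerFun_rbr_of_ne {i : Fin m} {k : Particle m} (hk : k ≠ Sum.inr i) :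
    etaDerFun i (rbr ξ k : EvenFun m τ ξ) = 0 := by
  simp only [rbr, derivation_br, etaDerFun_sig_of_ne hk, etaDerFun_cst, br_zero_left,
    br_zero_right, add_zero]

/-- The factor `(1ξ)(2ξ)`, by which `ηᵢ` scales `(ξi)`. -/
def refProd (m : ℕ) (τ : Fin 2 → Fin 2 → ℂ) (ξ : Fin 2 → ℂ) : EvenFun m τ ξ :=
  br (sig (Sum.inl 0)) (cst ξ) * br (sig (Sum.inl 1)) (cst ξ)

theorem etaDerFun_rbr_self (i : Fin m) :
    etaDerFun i (rbr ξ (Sum.inr i) : EvenFun m τ ξ) =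
      -(refProd m τ ξ * rbr ξ (Sum.inr i)) := by
  have h : etaDerFun i (rbr ξ (Sum.inr i) : EvenFun m τ ξ) = br (cst ξ) (eta ξ i) := by
    simp only [rbr, derivation_br, etaDerFun_sig_self, etaDerFun_cst, br_zero_left, zero_add]
  rw [h, eta, br_etaSpinor_self, rbr, refProd]

/-- The factor `(ξi)⁻²` as an even integrand. -/
def refInvSq (i : Fin m) : Even m τ ξ := ev (Ring.inverse (rbr ξ (Sum.inr i)) ^ 2)

theorem rbr_sq_mul_refInvSq (i : Fin m) :
    (ev (rbr ξ (Sum.inr i)) ^ 2 * refInvSq i : Even m τ ξ) = 1 := by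
  rw [refInvSq, ← ev_pow, ← ev_mul, ← mul_pow, Ring.mul_inverse_cancel _ (isUnit_rbr i), one_pow,
    ev_one]

theorem etaDer_refInvSq_self (i : Fin m) :
    etaDer i (refInvSq i : Even m τ ξ) = ev (2 * refProd m τ ξ) * refInvSq i := by
  rw [refInvSq, etaDer_ev, ← ev_mul, pow_two, Derivation.leibniz,
    derivation_ringInverse _ (isUnit_rbr i), etaDerFun_rbr_self, smul_eq_mul]
  congr 1
  linear_combination (2 * refProd m τ ξ * Ring.inverse (rbr ξ (Sum.inr i)) ^ 2) *
    Ring.mul_inverse_cancel _ (isUnit_rbr (τ := τ) (ξ := ξ) i)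

theorem etaDer_refInvSq_of_ne {i j : Fin m} (h : j ≠ i) :
    etaDer i (refInvSq j : Even m τ ξ) = 0 := by
  rw [refInvSq, etaDer_ev, pow_two, Derivation.leibniz, derivation_ringInverse _ (isUnit_rbr j),
    etaDerFun_rbr_of_ne (Sum.inr_injective.ne h), mul_zero, neg_zero, smul_zero, add_zero, ev_zero]

theorem etaDer_hodgesOff {i j : Fin m} {k : Particle m} (h : k ≠ Sum.inr j) (s : ℂ) :
    etaDer i (hodgesOff s (Sum.inr j) k : Even m τ ξ) = wbr s (Sum.inr j) k *
      ev (Ring.inverse (sbr (Sum.inr j) k) ^ 2 * etaDerFun i (sbr (Sum.inr j) k)) := by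
  rw [hodgesOff_eq, map_neg, Derivation.leibniz, etaDer_wbr, smul_zero, add_zero, etaDer_ev,
    derivation_ringInverse _ (isUnit_sbr h), ev_neg, smul_eq_mul, mul_neg, neg_neg]

theorem etaDer_hodgesOff_of_ne {i j : Fin m} {k : Particle m} (hj : j ≠ i) (hk : k ≠ Sum.inr i)
    (hkj : k ≠ Sum.inr j) (s : ℂ) :
    etaDer i (hodgesOff s (Sum.inr j) k : Even m τ ξ) = 0 := by
  rw [etaDer_hodgesOff hkj, etaDerFun_sbr_of_ne (Sum.inr_injective.ne hj) hk, mul_zero, ev_zero,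
    mul_zero]

theorem etaDer_core_of_ne {i j k : Fin m} (hj : j ≠ i) (hk : k ≠ i) (hjk : j ≠ k) (s : ℂ) :
    etaDer i (core s ξ j k : Even m τ ξ) = 0 := by
  rw [core_of_ne s ξ hjk, etaDer_hodgesOff_of_ne hj (Sum.inr_injective.ne hk)
    (Sum.inr_injective.ne hjk.symm)]

theorem etaDer_core_swap {i j : Fin m} (h : i ≠ j) (s : ℂ) :
    etaDer i (core s ξ i j : Even m τ ξ) = -etaDer j (core s ξ i j) := by
  have hji : (Sum.inr j : Particle m) ≠ Sum.inr i := Sum.inr_injective.ne h.symm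
  have hanti : (br (eta ξ i) (sig (Sum.inr j)) : EvenFun m τ ξ) =
      -br (sig (Sum.inr i)) (eta ξ j) :=
    eq_neg_of_add_eq_zero_left (br_etaSpinor_add_br_etaSpinor _ _ _ _ _)
  rw [core_of_ne s ξ h, etaDer_hodgesOff hji, etaDer_hodgesOff hji, etaDerFun_sbr_left hji,
    etaDerFun_sbr_right hji.symm, hanti, mul_neg, ev_neg, mul_neg]

theorem refInvSq_mul_etaDer_core_self {i j : Fin m} (h : i ≠ j) (s : ℂ) :
    refInvSq i * etaDer i (core s ξ j j : Even m τ ξ) =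
      (ev (2 * refProd m τ ξ) * core s ξ i j - etaDer i (core s ξ i j)) * refInvSq j := by
  have hmem : (Sum.inr i : Particle m) ∈ Finset.univ.erase (Sum.inr j : Particle m) :=
    Finset.mem_erase.2 ⟨Sum.inr_injective.ne h, Finset.mem_univ _⟩
  have hterm (k : Particle m) : (hodgesOff s (Sum.inr j) k *
      ev (rbr ξ k ^ 2 * Ring.inverse (rbr ξ (Sum.inr j)) ^ 2) : Even m τ ξ) =
      hodgesOff s (Sum.inr j) k * (ev (rbr ξ k) ^ 2 * refInvSq j) := by
    rw [ev_mul, ev_pow, refInvSq]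
  have hrest : ∑ k ∈ (Finset.univ.erase (Sum.inr j : Particle m)).erase (Sum.inr i), etaDer i
      (hodgesOff s (Sum.inr j) k * (ev (rbr ξ k) ^ 2 * refInvSq j) : Even m τ ξ) = 0 := by
    refine Finset.sum_eq_zero fun k hk => ?_
    obtain ⟨hki, hkj, -⟩ : k ≠ Sum.inr i ∧ k ≠ Sum.inr j ∧ _ := by
      simpa only [Finset.mem_erase] using hk
    rw [Derivation.leibniz, Derivation.leibniz, Derivation.leibniz_pow,
      etaDer_hodgesOff_of_ne h.symm hki hkj, etaDer_ev, etaDerFun_rbr_of_ne hki, ev_zero,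
      etaDer_refInvSq_of_ne h.symm]
    simp only [smul_zero, add_zero]
  simp only [core_self, hterm]
  rw [map_neg, map_sum, ← Finset.add_sum_erase _ _ hmem, hrest, Derivation.leibniz,
    Derivation.leibniz, Derivation.leibniz_pow, etaDer_refInvSq_of_ne h.symm, etaDer_ev,
    etaDerFun_rbr_self, ev_neg, ev_mul, hodgesOff_swap, ← core_of_ne s ξ h, two_mul, ev_add]
  simp only [smul_eq_mul, nsmul_eq_mul, mul_zero, add_zero, zero_add, Nat.cast_ofNat,
    Nat.add_one_sub_one, pow_one]
  linear_combination ((ev (refProd m τ ξ) + ev (refProd m τ ξ)) * core s ξ i j -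
    etaDer i (core s ξ i j)) * refInvSq j * rbr_sq_mul_refInvSq i

theorem sum_etaDer_adjugate (s : ℂ) (k : Fin m) :
    ∑ i, refInvSq i * etaDer i ((core s ξ).adjugate k i : Even m τ ξ) +
      ev (2 * refProd m τ ξ) * ∑ i, refInvSq i * (core s ξ).adjugate k i =
      ev (2 * refProd m τ ξ) * (refInvSq k * (core s ξ).adjugate k k) :=
  sum_derivation_adjugate (R := ℂ) (A := Even m τ ξ) (core_isSymm s ξ) (δ := etaDer)
    (u := refInvSq) (b := ev (2 * refProd m τ ξ))
    (fun _ _ _ hj hk hjk => etaDer_core_of_ne hj hk hjk s)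
    (fun _ _ h => etaDer_core_swap h s)
    (fun _ _ h => refInvSq_mul_etaDer_core_self h s) k

theorem etaDerFun_nullVec (k : Fin m) :
    etaDerFun k (nullVec (Sum.inr k) : EvenFun m τ ξ) =
      2 * refProd m τ ξ * nullVec (Sum.inr k) +
        sbr (Sum.inl 0) (Sum.inl 1) ^ 2 * rbr ξ (Sum.inr k) ^ 2 := by
  rw [nullVec, Derivation.leibniz, etaDerFun_sbr_right Sum.inl_ne_inr,
    etaDerFun_sbr_right Sum.inl_ne_inr]
  exact br_mul_br_etaSpinor_add _ _ _ _

theorem etaDerFun_nullInv_self (k : Fin m) :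
    etaDerFun k (nullInv k : EvenFun m τ ξ) = -(2 * refProd m τ ξ * nullInv k +
      sbr (Sum.inl 0) (Sum.inl 1) ^ 2 * nullInv k ^ 2 * rbr ξ (Sum.inr k) ^ 2) := by
  have h := nullVec_mul_nullInv (τ := τ) (ξ := ξ) k
  rw [Derivation.leibniz_of_mul_eq_one _ ((mul_comm _ _).trans h), etaDerFun_nullVec, smul_eq_mul]
  linear_combination (-2 * refProd m τ ξ * nullInv k) * h

theorem etaDerFun_nullInv_of_ne {i k : Fin m} (h : k ≠ i) :
    etaDerFun i (nullInv k : EvenFun m τ ξ) = 0 := by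
  have hp (p : Fin 2) :
      etaDerFun i (Ring.inverse (sbr (Sum.inl p) (Sum.inr k)) : EvenFun m τ ξ) = 0 := by
    rw [derivation_ringInverse _ (isUnit_sbr_inl p k),
      etaDerFun_sbr_of_ne Sum.inl_ne_inr (Sum.inr_injective.ne h), mul_zero, neg_zero]
  rw [nullInv, Derivation.leibniz, hp, hp, smul_zero, smul_zero, add_zero]

theorem sum_sigDer_eta_adjugate (s : ℂ) (k : Fin m) :
    ∑ i, ∑ A, sigDer i A (ev (eta ξ i A) *
      (ev (nullInv k) * (refInvSq i * (core s ξ).adjugate k i)) : Even m τ ξ) =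
      -(ev (sbr (Sum.inl 0) (Sum.inl 1) ^ 2 * nullInv k ^ 2) * (core s ξ).adjugate k k) := by
  have hterm (i : Fin m) :
      etaDer i (ev (nullInv k) * (refInvSq i * (core s ξ).adjugate k i) : Even m τ ξ) =
      ev (nullInv k) * (refInvSq i * etaDer i ((core s ξ).adjugate k i)) +
      ev (nullInv k) * (ev (2 * refProd m τ ξ) * (refInvSq i * (core s ξ).adjugate k i)) +
      if k = i then ev (etaDerFun k (nullInv k)) * (refInvSq k * (core s ξ).adjugate k k)
        else 0 := by
    rw [Derivation.leibniz, Derivation.leibniz, etaDer_refInvSq_self, etaDer_ev]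
    simp only [smul_eq_mul]
    split_ifs with h
    · subst h; ring
    · rw [etaDerFun_nullInv_of_ne h, ev_zero]; ring
  simp only [sum_sigDer_eta, hterm, Finset.sum_add_distrib, ← Finset.mul_sum, Finset.sum_ite_eq,
    Finset.mem_univ, if_true]
  have hdiv := sum_etaDer_adjugate (τ := τ) (ξ := ξ) s k
  have hunit := rbr_sq_mul_refInvSq (τ := τ) (ξ := ξ) k
  rw [etaDerFun_nullInv_self, ev_neg, ev_add, ev_mul (2 * refProd m τ ξ), ev_mul _ (rbr _ _ ^ 2),
    ev_pow (rbr _ _)]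
  linear_combination ev (nullInv k) * hdiv - ev (sbr (Sum.inl 0) (Sum.inl 1) ^ 2 *
    nullInv k ^ 2) * (core s ξ).adjugate k k * hunit

/-! ### The thrice-reduced form -/

/-- The integral as a linear map. -/
def integralHom : Even m τ ξ →ₗ[ℂ] IntegralValue m τ ξ :=
  (totalDerivatives m τ ξ).mkQ ∘ₗ (Subalgebra.center ℂ (Integrand m τ ξ)).val.toLinearMap ∘ₗ
    LinearMap.mulLeft ℂ (ev (br (sig (Sum.inl 0)) (sig (Sum.inl 1)) ^ 2))

theorem integral_add (F G : Even m τ ξ) : integral (F + G) = integral F + integral G :=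
  map_add integralHom F G

theorem integral_smul (c : ℂ) (F : Even m τ ξ) : integral (c • F) = c • integral F :=
  map_smul integralHom c F

theorem integral_sum {κ : Type*} (t : Finset κ) (F : κ → Even m τ ξ) :
    integral (∑ k ∈ t, F k) = ∑ k ∈ t, integral (F k) :=
  map_sum integralHom F t

theorem integral_eq_of_sub_mem {F G : Even m τ ξ} (h : F - G ∈ exactIntegrands m τ ξ) :
    integral F = integral G := by
  have hc : ev (br (sig (Sum.inl 0)) (sig (Sum.inl 1)) ^ 2 : EvenFun m τ ξ) =
      algebraMap ℂ (Even m τ ξ) (br (τ 0) (τ 1) ^ 2) := by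
    have h0 : (br (sig (Sum.inl 0)) (sig (Sum.inl 1)) : EvenFun m τ ξ) =
        algebraMap ℂ _ (br (τ 0) (τ 1)) := by
      simp only [br, sig_inl, cst, map_sub, map_mul]
    rw [h0, ← map_pow]
    exact evHom.commutes _
  refine (Submodule.Quotient.eq _).2 ?_
  rw [hc, ← Algebra.smul_def, ← Algebra.smul_def]
  have h' := Submodule.smul_mem _ (br (τ 0) (τ 1) ^ 2) h
  rw [smul_sub] at h'
  exact h'

theorem coeff_eq (i j : Fin m) : (coeff i j : Even m τ ξ) =
    ev (sbr (Sum.inl 0) (Sum.inl 1) ^ 2) * (ev (nullInv i) * ev (nullInv j)) := by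
  rw [← ev_mul, ← ev_mul, nullInv, nullInv]
  refine congrArg ev ?_
  ring

theorem nullInv_mem_xFreeFun (i : Fin m) : nullInv i ∈ xFreeFun m τ ξ :=
  mul_mem (ringInverse_mem_xFreeFun (sbr_mem_xFreeFun _ _))
    (ringInverse_mem_xFreeFun (sbr_mem_xFreeFun _ _))

theorem refInvSq_mem_xFree (i : Fin m) : refInvSq i ∈ xFree m τ ξ :=
  ev_mem_xFree (pow_mem (ringInverse_mem_xFreeFun (rbr_mem_xFreeFun ξ _)) 2)

open Matrix in
theorem det_core_eq_sum_momentumAt_mul (s : ℂ) (k : Fin m) :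
    ((core s ξ).det : Even m τ ξ) = ∑ i, momentumAt s (Sum.inr i) (eta ξ i) *
      (ev (nullInv k) * (refInvSq i * (core s ξ).adjugate k i)) := by
  set v : Fin m → Even m τ ξ := fun j => ev (nullVec (Sum.inr j))
  have hadj : ((core s ξ).adjugate *ᵥ (core s ξ *ᵥ v)) k = (core s ξ).det * v k := by
    rw [mulVec_mulVec, adjugate_mul, smul_mulVec, one_mulVec, Pi.smul_apply, smul_eq_mul]
  have hunit : v k * ev (nullInv k) = 1 := by rw [← ev_mul, nullVec_mul_nullInv, ev_one]
  calc (core s ξ).det = (core s ξ).det * v k * ev (nullInv k) := by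
        rw [mul_assoc, hunit, mul_one]
    _ = (∑ i, (core s ξ).adjugate k i * (core s ξ *ᵥ v) i) * ev (nullInv k) := by
        rw [← hadj]; rfl
    _ = _ := by
        rw [Finset.sum_mul]
        refine Finset.sum_congr rfl fun i _ => ?_
        rw [core_mulVec_nullVec s ξ i (isUnit_rbr i), refInvSq]
        ring

theorem integral_xsq_sq_mul_det_core (s : ℂ) (k : Fin m) :
    integral (xsq s ^ 2 * (core s ξ).det : Even m τ ξ) =
      s ^ 2 • integral ((-2 : ℂ) • (xsq s * coeff k k * (core s ξ).adjugate k k)) := by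
  rw [← integral_smul]
  apply integral_eq_of_sub_mem
  have h := sum_mem (t := Finset.univ) fun (i : Fin m) _ =>
    xsq_sq_mul_momentumAt_mem s i (eta_mem_xFreeFun (τ := τ) (ξ := ξ) ξ i)
      (mul_mem (ev_mem_xFree (nullInv_mem_xFreeFun k)) (mul_mem
        (refInvSq_mem_xFree i) (adjugate_mem (core_mem_xFree s ξ) k i)))
  rw [Finset.sum_sub_distrib, ← Finset.mul_sum, ← det_core_eq_sum_momentumAt_mul,
    ← Finset.smul_sum, ← Finset.mul_sum, sum_sigDer_eta_adjugate] at h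
  convert h using 2
  rw [coeff_eq, ev_mul, ev_pow (nullInv k), smul_smul]
  simp only [Algebra.smul_def, map_mul, map_pow, map_neg, map_ofNat]
  ring

theorem amplitude_eq_thriceReduced {s : ℂ} (hs : s ≠ 0) (i : Fin m) :
    amplitude m τ ξ s = thriceReduced m τ ξ s i := by
  rw [amplitude, thriceReduced, reduced_empty, reduced_singleton, integral_add, integral_add,
    integral_xsq_sq_mul_det_core s i, smul_add, smul_smul, inv_mul_cancel₀ (pow_ne_zero 2 hs),
    one_smul, integral_smul (s ^ 2)⁻¹]

/-! ### The flat-space formulas -/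

/-- The ideal of those elements of `xFree` whose product with `X²` and any element of `xFree`
integrates to zero at `Λ = 0`. -/
def flatNull (m : ℕ) (τ : Fin 2 → Fin 2 → ℂ) (ξ : Fin 2 → ℂ) : Ideal (xFree m τ ξ) where
  carrier := {z | ∀ g : xFree m τ ξ,
    xsq 0 * ((z * g : xFree m τ ξ) : Even m τ ξ) ∈ exactIntegrands m τ ξ}
  add_mem' {x y} hx hy g := by
    rw [add_mul, Subalgebra.coe_add, mul_add]
    exact add_mem (hx g) (hy g)
  zero_mem' g := by
    rw [zero_mul, Subalgebra.coe_zero, mul_zero]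
    exact zero_mem _
  smul_mem' c z hz g := by
    rw [smul_eq_mul, mul_comm c, mul_assoc]
    exact hz _

/-- The twice-reduced Hodges matrix as a matrix over `xFree`, where the ideal `flatNull` lives. -/
def coreFree (s : ℂ) (ζ : Fin 2 → ℂ) : Matrix (Fin m) (Fin m) (xFree m τ ξ) :=
  fun i j => ⟨core s ζ i j, core_mem_xFree s ζ i j⟩

theorem coe_adjugate_coreFree (s : ℂ) (ζ : Fin 2 → ℂ) (i j : Fin m) :
    (((coreFree s ζ).adjugate i j : xFree m τ ξ) : Even m τ ξ) = (core s ζ).adjugate i j :=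
  congrFun (congrFun ((xFree m τ ξ).val.toRingHom.map_adjugate (coreFree s ζ)) i) j

theorem momentum_mem_xFree (s : ℂ) (i : Particle m) (A : Fin 2) :
    momentum s i A ∈ xFree m τ ξ :=
  sum_mem fun j _ => mul_mem (wbr_mem_xFree s i j) (ev_mem_xFree (sig_mem_xFreeFun j A))

theorem momentum_mem_flatNull (i : Particle m) (A : Fin 2) :
    (⟨momentum 0 i A, momentum_mem_xFree 0 i A⟩ : xFree m τ ξ) ∈ flatNull m τ ξ :=
  fun g => xsq_zero_mul_momentum_mem i A g.2

/-- The vector `(1k)(2k)` with entries in `xFree`. -/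
def nullVecFree (i : Fin m) : xFree m τ ξ :=
  ⟨ev (nullVec (Sum.inr i)), ev_mem_xFree (mul_mem (sbr_mem_xFreeFun _ _) (sbr_mem_xFreeFun _ _))⟩

open Matrix in
theorem coreFree_mulVec_mem_flatNull {ζ : Fin 2 → ℂ}
    (hζ : ∀ i : Fin m, IsUnit (rbr ζ (Sum.inr i) : EvenFun m τ ξ)) (i : Fin m) :
    (coreFree 0 ζ *ᵥ nullVecFree) i ∈ flatNull m τ ξ := by
  let η (A) : xFree m τ ξ := ⟨ev (eta ζ i A), ev_mem_xFree (eta_mem_xFreeFun ζ i A)⟩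
  let P (A) : xFree m τ ξ := ⟨momentum 0 (Sum.inr i) A, momentum_mem_xFree 0 _ A⟩
  let r : xFree m τ ξ := ⟨ev (Ring.inverse (rbr ζ (Sum.inr i)) ^ 2),
    ev_mem_xFree (pow_mem (ringInverse_mem_xFreeFun (rbr_mem_xFreeFun ζ _)) 2)⟩
  have h : (coreFree 0 ζ *ᵥ nullVecFree) i = r * (η 0 * P 1 - η 1 * P 0) := by
    refine Subtype.ext (Eq.trans ?_ ((core_mulVec_nullVec 0 ζ i (hζ i)).trans ?_))
    · exact map_sum (xFree m τ ξ).val _ _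
    · rw [momentumAt_eq]
      rfl
  rw [h]
  exact Ideal.mul_mem_left _ _ (sub_mem (Ideal.mul_mem_left _ _ (momentum_mem_flatNull _ _))
    (Ideal.mul_mem_left _ _ (momentum_mem_flatNull _ _)))

theorem integral_flat_eq {ζ ζ' : Fin 2 → ℂ}
    (hζ : ∀ i : Fin m, IsUnit (rbr ζ (Sum.inr i) : EvenFun m τ ξ))
    (hζ' : ∀ i : Fin m, IsUnit (rbr ζ' (Sum.inr i) : EvenFun m τ ξ)) (a b c d : Fin m) :
    integral (xsq 0 * (coeff a b * (core 0 ζ).adjugate b a) : Even m τ ξ) =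
      integral (xsq 0 * (coeff c d * (core 0 ζ').adjugate d c)) := by
  let w (i : Fin m) : xFree m τ ξ := ⟨ev (nullInv i), ev_mem_xFree (nullInv_mem_xFreeFun i)⟩
  have h := adjugate_normalized_sub_mem (flatNull m τ ξ) (M := coreFree 0 ζ) (M' := coreFree 0 ζ')
    (v := nullVecFree) (w := w)
    (Matrix.IsSymm.ext fun i j => Subtype.ext ((core_isSymm 0 ζ).apply i j))
    (fun i j hij => Subtype.ext ((core_of_ne 0 ζ hij).trans (core_of_ne 0 ζ' hij).symm))
    (fun i => Subtype.ext (by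
      change ev (nullVec _) * ev (nullInv i) = 1
      rw [← ev_mul, nullVec_mul_nullInv, ev_one]))
    (coreFree_mulVec_mem_flatNull hζ) (coreFree_mulVec_mem_flatNull hζ') b a d c
    ⟨ev (sbr (Sum.inl 0) (Sum.inl 1) ^ 2), ev_mem_xFree (pow_mem (sbr_mem_xFreeFun _ _) 2)⟩
  apply integral_eq_of_sub_mem
  rw [coeff_eq, coeff_eq, ← mul_sub]
  convert h using 2
  simp only [Subalgebra.coe_mul, Subalgebra.coe_sub, coe_adjugate_coreFree, w]
  ring

theorem hodgesAmplitude_eq_hodgesAmplitude {ζ ζ' : Fin 2 → ℂ}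
    (hζ : ∀ i : Fin m, IsUnit (rbr ζ (Sum.inr i) : EvenFun m τ ξ))
    (hζ' : ∀ i : Fin m, IsUnit (rbr ζ' (Sum.inr i) : EvenFun m τ ξ)) (i j : Fin m) :
    hodgesAmplitude m τ ξ ζ i = hodgesAmplitude m τ ξ ζ' j := by
  rw [hodgesAmplitude, hodgesAmplitude, reduced_singleton, reduced_singleton, mul_assoc,
    mul_assoc, integral_flat_eq hζ hζ' i i j j]

theorem flatSum_eq_smul {ζ : Fin 2 → ℂ}
    (hζ : ∀ i : Fin m, IsUnit (rbr ζ (Sum.inr i) : EvenFun m τ ξ)) (k : Fin m) :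
    flatSum m τ ξ ζ = (m * (m + 1) : ℂ) • hodgesAmplitude m τ ξ ζ k := by
  have h (i j : Fin m) : integral (xsq 0 * (coeff i j * (core 0 ζ).adjugate j i)) =
      hodgesAmplitude m τ ξ ζ k := by
    rw [hodgesAmplitude, reduced_singleton, mul_assoc, integral_flat_eq hζ hζ i j k k]
  have hOff (i j : Fin m) : (reducedOff 0 ζ i j : Even m τ ξ) = (core 0 ζ).adjugate j i := rfl
  simp only [flatSum, hOff, reduced_singleton, mul_add, Finset.mul_sum, integral_add,
    integral_sum, h, Finset.sum_const, Finset.card_univ, Fintype.card_fin,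
    ← Nat.cast_smul_eq_nsmul ℂ, smul_smul, ← add_smul]
  congr 1
  ring

/-! ### Polynomial dependence on `s` -/

theorem isPolyIn_infUpper (α β : Fin 4) : IsPolyIn fun s => infUpper (s ^ 2) α β := by
  have h := isPolyIn_pow (k := ℂ) 2
  have h0 := IsPolyIn.const (k := ℂ) (0 : ℂ)
  have h1 := IsPolyIn.const (k := ℂ) (1 : ℂ)
  fin_cases α <;> fin_cases β <;>
    first | exact h0 | exact h | exact h.neg | exact h1 | exact h1.neg

theorem isPolyIn_infLower (α β : Fin 4) : IsPolyIn fun s => infLower (s ^ 2) α β := by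
  have h := isPolyIn_pow (k := ℂ) 2
  have h0 := IsPolyIn.const (k := ℂ) (0 : ℂ)
  have h1 := IsPolyIn.const (k := ℂ) (1 : ℂ)
  fin_cases α <;> fin_cases β <;>
    first | exact h0 | exact h | exact h.neg | exact h1 | exact h1.neg

theorem isPolyIn_wbr (i j : Particle m) : IsPolyIn fun s => (wbr s i j : Even m τ ξ) := by
  simp only [wbr_eq]
  exact (IsPolyIn.sum _ fun α => IsPolyIn.sum _ fun β =>
    (isPolyIn_infUpper α β).smul (IsPolyIn.const _)).sub (isPolyIn_id.smul (IsPolyIn.const _))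

theorem isPolyIn_xsq : IsPolyIn fun s => (xsq s : Even m τ ξ) := by
  simp only [xsq_eq]
  exact (IsPolyIn.sum _ fun α => IsPolyIn.sum _ fun β =>
    (isPolyIn_infLower α β).smul (IsPolyIn.const _)).add (isPolyIn_id.smul (IsPolyIn.const _))

theorem isPolyIn_hodgesOff (i j : Particle m) :
    IsPolyIn fun s => (hodgesOff s i j : Even m τ ξ) := by
  simp only [hodgesOff_eq]
  exact ((isPolyIn_wbr i j).mul (IsPolyIn.const _)).neg

theorem isPolyIn_core (ζ : Fin 2 → ℂ) (i j : Fin m) :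
    IsPolyIn fun s => (core s ζ i j : Even m τ ξ) := by
  rcases eq_or_ne i j with rfl | h
  · simp only [core_self]
    exact (IsPolyIn.sum _ fun k => (isPolyIn_hodgesOff _ k).mul (IsPolyIn.const _)).neg
  · simp only [core_of_ne _ ζ h]
    exact isPolyIn_hodgesOff _ _

theorem isPolyIn_reduced (ζ : Fin 2 → ℂ) (T : Finset (Fin m)) :
    IsPolyIn fun s => (reduced s ζ T : Even m τ ξ) :=
  IsPolyIn.det (M := fun s => (core s ζ).submatrix (Subtype.val : {i // i ∉ T} → Fin m)
    Subtype.val) fun i j => isPolyIn_core ζ i.1 j.1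

/-- The propagator `omega` without its factor `Λ`. -/
def propagator (s : ℂ) (p : Fin 2) (i j : Fin m) : Even m τ ξ :=
  wbr s (Sum.inr i) (Sum.inr j) *
    ev (rbr ξ (Sum.inl p) ^ 4 * sbr (Sum.inr i) (Sum.inr j) *
      Ring.inverse (sbr (Sum.inl p) (Sum.inr i)) ^ 2 *
      Ring.inverse (sbr (Sum.inl p) (Sum.inr j)) ^ 2 *
      Ring.inverse (rbr ξ (Sum.inr i)) ^ 2 * Ring.inverse (rbr ξ (Sum.inr j)) ^ 2)

theorem isPolyIn_propagator (p : Fin 2) (i j : Fin m) :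
    IsPolyIn fun s => (propagator s p i j : Even m τ ξ) :=
  (isPolyIn_wbr _ _).mul (IsPolyIn.const _)

/-- The sum `omegaTerm` without the factors `Λ` of its two propagators. -/
def propagatorSum (m : ℕ) (τ : Fin 2 → Fin 2 → ℂ) (ξ : Fin 2 → ℂ) (s : ℂ) : Even m τ ξ :=
  ∑ t : Fin 4 ↪ Fin m, propagator s 0 (t 0) (t 1) * propagator s 1 (t 2) (t 3) *
    reduced s ξ (Finset.univ.map t)

theorem omegaTerm_eq (s : ℂ) : omegaTerm s = s ^ 4 • propagatorSum m τ ξ s := by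
  have h (p : Fin 2) (i j : Fin m) : (omega s p i j : Even m τ ξ) = s ^ 2 • propagator s p i j :=
    rfl
  rw [omegaTerm, propagatorSum, Finset.smul_sum]
  refine Finset.sum_congr rfl fun t _ => ?_
  rw [h, h, smul_mul_smul_comm, smul_mul_assoc, ← pow_add]

/-- The integrand of the thrice-reduced form, with the factor `1 / Λ` cancelled. -/
def thriceReducedIntegrand (m : ℕ) (τ : Fin 2 → Fin 2 → ℂ) (ξ : Fin 2 → ℂ) (i : Fin m) (s : ℂ) :
    Even m τ ξ :=
  (-2 : ℂ) • (xsq s * coeff i i * reduced s ξ {i}) + s ^ 2 • propagatorSum m τ ξ s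

theorem isPolyIn_thriceReducedIntegrand (i : Fin m) :
    IsPolyIn (thriceReducedIntegrand m τ ξ i) :=
  ((IsPolyIn.const _).smul ((isPolyIn_xsq.mul (IsPolyIn.const _)).mul (isPolyIn_reduced ξ _))).add
    ((isPolyIn_pow 2).smul (IsPolyIn.sum _ fun _ =>
      ((isPolyIn_propagator 0 _ _).mul (isPolyIn_propagator 1 _ _)).mul (isPolyIn_reduced ξ _)))

theorem thriceReduced_eq_integral {s : ℂ} (hs : s ≠ 0) (i : Fin m) :
    thriceReduced m τ ξ s i = integral (thriceReducedIntegrand m τ ξ i s) := by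
  have h4 : (s ^ 2)⁻¹ * s ^ 4 = s ^ 2 := by field_simp
  rw [thriceReduced, thriceReducedIntegrand, omegaTerm_eq, smul_smul, h4]

theorem integral_thriceReducedIntegrand_zero (i : Fin m) :
    integral (thriceReducedIntegrand m τ ξ i 0) = (-2 : ℂ) • hodgesAmplitude m τ ξ ξ i := by
  rw [hodgesAmplitude, ← integral_smul, thriceReducedIntegrand, zero_pow two_ne_zero, zero_smul,
    add_zero]

theorem exists_coefficients_thriceReduced (m : ℕ) (τ : Fin 2 → Fin 2 → ℂ) (ξ : Fin 2 → ℂ)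
    (i : Fin m) : ∃ c : ℕ →₀ IntegralValue m τ ξ,
      (∀ s, s ≠ 0 → thriceReduced m τ ξ s i = c.sum fun d v => s ^ d • v) ∧
      c 0 = (-2 : ℂ) • hodgesAmplitude m τ ξ ξ i := by
  obtain ⟨c, hc, hc0⟩ :=
    (isPolyIn_thriceReducedIntegrand (τ := τ) (ξ := ξ) i).exists_eq_sum_pow_smul integralHom
  exact ⟨c, fun s hs => (thriceReduced_eq_integral hs i).trans (hc s),
    hc0.trans (integral_thriceReducedIntegrand_zero i)⟩

end Integrand

end MHV

end

theorem mainTheorem3 (m : ℕ) (hm : 1 ≤ m) (τ : Fin 2 → Fin 2 → ℂ) (hτ : MHV.br (τ 0) (τ 1) ≠ 0)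
    (ξ : Fin 2 → ℂ) (hξ : ξ ≠ 0) :
    (∀ s : ℂ, s ≠ 0 → ∀ i : Fin m,
      MHV.amplitude m τ ξ s = MHV.thriceReduced m τ ξ s i) ∧
    ∃ c : ℕ →₀ MHV.IntegralValue m τ ξ,
      (∀ s : ℂ, s ≠ 0 → MHV.amplitude m τ ξ s = c.sum fun d v => s ^ d • v) ∧
      ∀ ζ : Fin 2 → ℂ,
        (∀ i : Fin m, IsUnit (MHV.rbr ζ (Sum.inr i) : MHV.EvenFun m τ ξ)) →
        c 0 = (-2 / (m * (m + 1)) : ℂ) • MHV.flatSum m τ ξ ζ ∧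
        ∀ i : Fin m, c 0 = (-2 : ℂ) • MHV.hodgesAmplitude m τ ξ ζ i := by
  let k : Fin m := ⟨0, hm⟩
  obtain ⟨c, hc, hc0⟩ := MHV.exists_coefficients_thriceReduced m τ ξ k
  refine ⟨fun s hs => MHV.amplitude_eq_thriceReduced hs, c, fun s hs => ?_, fun ζ hζ => ?_⟩
  · rw [MHV.amplitude_eq_thriceReduced hs k, hc s hs]
  · have h (i : Fin m) : c 0 = (-2 : ℂ) • MHV.hodgesAmplitude m τ ξ ζ i := by
      rw [hc0, MHV.hodgesAmplitude_eq_hodgesAmplitude MHV.isUnit_rbr hζ k i]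
    have hm0 : (m * (m + 1) : ℂ) ≠ 0 := by
      exact_mod_cast mul_ne_zero (Nat.one_le_iff_ne_zero.1 hm) m.succ_ne_zero
    refine ⟨?_, h⟩
    rw [h k, MHV.flatSum_eq_smul hζ k, smul_smul, div_mul_cancel₀ _ hm0]
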